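/- Let $\mathcal H$ be a finite set of linear hyperplanes in a finite-dimensional real inner product space $V$ (for instance $V=\mathbb R^n$) with $\bigcap\mathcal H=\{0\}$. After choosing an orientation of each hyperplane, every point $p$ of the unit sphere of $V$ has a sign vector in $\{0,-,+\}^{\mathcal H}$, recording whether $p$ lies on, on the negative side of, or on the positive side of each $h\in\mathcal H$. The sets of points of the unit sphere with a common sign vector are the cells of a regular cell decomposition $\Delta_{\mathcal H}$ of the sphere; a cell $\sigma$ is a face of a cell $\tau$ iff the sign vector of $\sigma$ arises from that of $\tau$ by replacing some entries by $0$. Assume that $\mathcal H$ is simplicial, i.e. that $\Delta_{\mathcal H}$ is a simplicial complex. Let $L_{\mathcal H}$ be the set of all intersections of members of $\mathcal H$, and let $\mathcal A\subseteq L_{\mathcal H}$ be an antichain with respect to inclusion (a subspace arrangement embedded in $\mathcal H$). Let $\Delta_{\mathcal A,\mathcal H}$ be the subcomplex of $\Delta_{\mathcal H}$ consisting of the cells contained in $\bigcup\mathcal A$. A finite simplicial complex is called shellable if it is pure, say of dimension $d-1$, and its facets can be totally ordered as $F_1,\dots,F_t$ in such a way that $F_j\cap\bigl(\bigcup_{i<j}F_i\bigr)$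 is pure of dimension $d-2$ for all $j=2,\dots,t$. (The empty simplex, of dimension $-1$, counts as a simplex.) **Theorem.** If $\mathcal A$ consists of hyperplanes, then $\Delta_{\mathcal A,\mathcal H}$ is shellable. In particular, let $n\ge 0$ and let $G$ be a simple graph on $[n]=\{1,\dots,n\}$. In the space $\{x\in\mathbb R^n : x_1+\dots+x_n=0\}$ let $\mathcal S_n$ be the braid arrangement of all hyperplanes $x_i=x_j$ with $1\le i<j\le n$, and let $\widehat G\subseteq\mathcal S_n$ be the graphical arrangement of the hyperplanes $x_i=x_j$ with $\{i,j\}$ an edge of $G$. Then $\mathcal S_n$ is simplicial and $\Delta_{\widehat G,\mathcal S_n}$ is shellable. Likewise, Steingrímsson's coloring complex $\Delta_G$ is shellable; its vertices are nonempty proper subsets of $[n]$, and its simplices are the chains $S_1\subsetneq\dots\subsetneq S_k$ of such subsets for which at least one of the blocks $S_{i+1}\setminus S_i$, $0\le i\le k$ (with $S_0=\emptyset$, $S_{k+1}=[n]$), contains both ends of an edge of $G$. -/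

import Mathlib

namespace HypArr

section Complexes

/-- All inclusion-maximal members of the family `S` of finite sets have exactly `k` elements.
For a simplicial complex (viewed as the family of all its simplices) this says that it is pure of
dimension `k - 1`. -/
def IsPure {α : Type*} (S : Set (Finset α)) (k : ℕ) : Prop :=
  ∀ s, Maximal (· ∈ S) s → s.card = k

/-- The facets (maximal simplices) of a simplicial complex. -/
def facets {α : Type*} (K : PreAbstractSimplicialComplex α) : Set (Finset α) :=
  {s | Maximal (· ∈ K.faces) s}

/-- `F` is a shelling order for the complex `K`, which is assumed to be pure of dimension `d - 1`:
it lists every facet exactly once, and for every `j` but the first, the intersection of the simplex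
`F j` with the union of the previous simplices is pure of dimension `d - 2`. That intersection is
the complex of all `s`, the empty simplex included, with `s ⊆ F j` and `s ⊆ F i` for some
`i < j`. -/
def IsShellingOrder {α : Type*} (K : PreAbstractSimplicialComplex α) (d : ℕ) {t : ℕ}
    (F : Fin t → Finset α) : Prop :=
  Function.Injective F ∧ Set.range F = facets K ∧
    ∀ j : Fin t, 0 < (j : ℕ) →
      ∃ k, k + 1 = d ∧ IsPure {s | s ⊆ F j ∧ ∃ i, i < j ∧ s ⊆ F i} k

/-- A finite simplicial complex is shellable if it is pure and its facets have a shelling order.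
(In a `PreAbstractSimplicialComplex` the empty simplex is left implicit.) -/
def Shellable {α : Type*} (K : PreAbstractSimplicialComplex α) : Prop :=
  K.faces.Finite ∧ ∃ d : ℕ, IsPure K.faces d ∧
    ∃ (t : ℕ) (F : Fin t → Finset α), IsShellingOrder K d F

end Complexes

section Arrangements

variable {V : Type*} [NormedAddCommGroup V] [InnerProductSpace ℝ V]

/-- A choice of orientation of a hyperplane `h`: a linear functional with kernel `h`. The positive
side of `h` is where it is positive. -/
noncomputable def orientation (h : Submodule ℝ V) : Module.Dual ℝ V :=
  Classical.epsilon fun φ : Module.Dual ℝ V => LinearMap.ker φ = h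

theorem ker_orientation {h : Submodule ℝ V} (hh : IsCoatom h) :
    LinearMap.ker (orientation h) = h := by
  refine Classical.epsilon_spec (p := fun φ : Module.Dual ℝ V => LinearMap.ker φ = h) ?_
  obtain ⟨φ, hφ, hle⟩ := Submodule.exists_le_ker_of_lt_top h (lt_top_iff_ne_top.2 hh.1)
  refine ⟨φ, (hh.le_iff.1 hle).resolve_left fun htop => hφ ?_⟩
  exact LinearMap.ker_eq_top.1 htop

/-- The sign vector of a point: on, on the negative side, or on the positive side of each
hyperplane of `H`. -/
noncomputable def signVector (H : Set (Submodule ℝ V)) (p : V) : H → SignType :=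
  fun h => SignType.sign (orientation h.1 p)

/-- The (nonempty) cells of the decomposition of the unit sphere induced by `H`, given by their sign
vectors. -/
def Cell (H : Set (Submodule ℝ V)) : Type _ :=
  {σ : H → SignType // ∃ p ∈ Metric.sphere (0 : V) 1, signVector H p = σ}

/-- The point set of a cell: all points of the unit sphere with the given sign vector. -/
def Cell.carrier {H : Set (Submodule ℝ V)} (σ : Cell H) : Set V :=
  {p | p ∈ Metric.sphere (0 : V) 1 ∧ signVector H p = σ.1}

/-- The face order on cells (that of the big face lattice of the oriented matroid of `H`):
`σ ≤ τ` iff `σ` arises from `τ` by replacing some signs by `0`. -/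
instance Cell.instPartialOrder (H : Set (Submodule ℝ V)) : PartialOrder (Cell H) where
  le σ τ := ∀ h, σ.1 h = 0 ∨ σ.1 h = τ.1 h
  le_refl _ _ := Or.inr rfl
  le_trans σ τ ρ h₁ h₂ h := by
    rcases h₁ h with e | e
    · exact Or.inl e
    · rw [e]
      exact h₂ h
  le_antisymm σ τ h₁ h₂ := Subtype.ext <| funext fun h => by
    rcases h₁ h with e | e
    · rcases h₂ h with e' | e'
      · rw [e, e']
      · exact e'.symm
    · exact e

/-- The vertices of a cell: the minimal cells among its faces. -/
def Cell.vertices {H : Set (Submodule ℝ V)} (σ : Cell H) : Set (Cell H) :=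
  {v | IsMin v ∧ v ≤ σ}

/-- A simplicial hyperplane arrangement: a finite set of linear hyperplanes with intersection `{0}`
such that the induced cell decomposition of the unit sphere is a simplicial complex, i.e. taking
vertex sets is an isomorphism from the poset of cells onto the poset of (nonempty) simplices of an
abstract simplicial complex. -/
structure IsSimplicialArrangement (H : Set (Submodule ℝ V)) : Prop where
  finite : H.Finite
  hyperplane : ∀ h ∈ H, IsCoatom h
  essential : sInf H = ⊥
  le_of_vertices_subset : ∀ σ τ : Cell H, σ.vertices ⊆ τ.vertices → σ ≤ τ
  vertices_nonempty : ∀ σ : Cell H, σ.vertices.Nonempty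
  exists_vertices_eq : ∀ (σ : Cell H) (t : Set (Cell H)), t ⊆ σ.vertices → t.Nonempty →
    ∃ τ : Cell H, τ.vertices = t

/-- The intersection lattice: all intersections of members of `H` (the empty intersection being the
whole space). -/
def intersectionLattice (H : Set (Submodule ℝ V)) : Set (Submodule ℝ V) :=
  {Y | ∃ S, S ⊆ H ∧ Y = sInf S}

/-- The subspace arrangement `A` is embedded in `H`: it is an antichain in the intersection
lattice of `H`. -/
def IsEmbedded (A H : Set (Submodule ℝ V)) : Prop :=
  A ⊆ intersectionLattice H ∧ IsAntichain (· ≤ ·) A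

/-- The subdivision by `H` of the link of `A`: the subcomplex of the cell decomposition consisting
of the cells that lie in the union of `A`, as a simplicial complex on the vertices of the
decomposition. For `H` simplicial and `A` embedded in `H`, its simplices are exactly the vertex sets
of those cells, see `mem_linkComplex_iff`. -/
def linkComplex (A H : Set (Submodule ℝ V)) : PreAbstractSimplicialComplex (Cell H) where
  faces := {s | s.Nonempty ∧ ∃ σ : Cell H,
    σ.carrier ⊆ (⋃ a ∈ A, (a : Set V)) ∧ (s : Set (Cell H)) ⊆ σ.vertices}
  isRelLowerSet_faces := by
    rintro s ⟨hs, σ, hσ, hsub⟩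
    exact ⟨hs, fun t hts ht => ⟨ht, σ, hσ, (Finset.coe_subset.2 hts).trans hsub⟩⟩

theorem mem_linkComplex_iff {A H : Set (Submodule ℝ V)} (hH : IsSimplicialArrangement H)
    (hA : IsEmbedded A H) (s : Finset (Cell H)) :
    s ∈ (linkComplex A H).faces ↔ ∃ σ : Cell H,
      σ.carrier ⊆ (⋃ a ∈ A, (a : Set V)) ∧ (s : Set (Cell H)) = σ.vertices := by
  have key : ∀ (h : H) (p : V), signVector H p h = 0 ↔ p ∈ h.1 := fun h p => by
    rw [signVector, sign_eq_zero_iff, ← LinearMap.mem_ker, ker_orientation (hH.hyperplane _ h.2)]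
  constructor
  · rintro ⟨hs, σ, hσ, hsub⟩
    obtain ⟨τ, hτ⟩ := hH.exists_vertices_eq σ s hsub (by simpa using hs)
    refine ⟨τ, ?_, hτ.symm⟩
    have hle := hH.le_of_vertices_subset τ σ (hτ ▸ hsub)
    obtain ⟨p, hp, hpσ⟩ := σ.2
    obtain ⟨a, ha, hpa⟩ := Set.mem_iUnion₂.1 (hσ ⟨hp, hpσ⟩)
    rintro q ⟨-, hq⟩
    refine Set.mem_iUnion₂.2 ⟨a, ha, ?_⟩
    obtain ⟨S, hS, rfl⟩ := hA.1 ha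
    refine (Submodule.mem_sInf).2 fun h hh => (key ⟨h, hS hh⟩ q).1 ?_
    have h0 := (key ⟨h, hS hh⟩ p).2 ((Submodule.mem_sInf).1 hpa h hh)
    rw [hq]
    rw [hpσ] at h0
    rcases hle ⟨h, hS hh⟩ with e | e
    · exact e
    · exact e.trans h0
  · rintro ⟨σ, hσ, hs⟩
    refine ⟨?_, σ, hσ, hs.subset⟩
    have := hH.vertices_nonempty σ
    rw [← hs] at this
    simpa using this

end Arrangements

section Graphs

/-- The subspace of `ℝⁿ` given by `x₁ + ⋯ + xₙ = 0`. -/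
def zeroSum (n : ℕ) : Submodule ℝ (EuclideanSpace ℝ (Fin n)) where
  carrier := {x | ∑ i, x i = 0}
  add_mem' {x y} hx hy := by
    simp only [Set.mem_ofPred_eq] at hx hy ⊢
    simp [Finset.sum_add_distrib, hx, hy]
  zero_mem' := by simp
  smul_mem' c x hx := by
    simp only [Set.mem_ofPred_eq] at hx ⊢
    simp [← Finset.mul_sum, hx]

/-- The subspace `xᵢ = xⱼ` of `zeroSum n`. -/
def eqHyperplane {n : ℕ} (i j : Fin n) : Submodule ℝ (zeroSum n) where
  carrier := {x | x.1 i = x.1 j}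
  add_mem' {x y} hx hy := by
    simp only [Set.mem_ofPred_eq] at hx hy ⊢
    simp [hx, hy]
  zero_mem' := by simp
  smul_mem' c x hx := by
    simp only [Set.mem_ofPred_eq] at hx ⊢
    simp [hx]

/-- The braid arrangement: all hyperplanes `xᵢ = xⱼ`, `i < j`. -/
def braidArrangement (n : ℕ) : Set (Submodule ℝ (zeroSum n)) :=
  {h | ∃ i j : Fin n, i < j ∧ h = eqHyperplane i j}

/-- The graphical arrangement of `G`: one hyperplane `xᵢ = xⱼ` for each edge `{i, j}`. -/
def graphicalArrangement {n : ℕ} (G : SimpleGraph (Fin n)) : Set (Submodule ℝ (zeroSum n)) :=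
  {h | ∃ i j : Fin n, G.Adj i j ∧ h = eqHyperplane i j}

/-- Steingrímsson's coloring complex of a graph `G` on `[n]`, in its combinatorial form. Vertices are
the nonempty proper subsets of `[n]`; simplices are the chains `S₁ ⊂ ⋯ ⊂ Sₖ` of such subsets for
which some block `Sᵢ₊₁ \ Sᵢ` (`0 ≤ i ≤ k`, `S₀ = ∅`, `Sₖ₊₁ = [n]`) contains an edge of `G`, i.e.
some edge of `G` has its two ends on the same side of every `Sᵢ`. -/
def coloringComplex {n : ℕ} (G : SimpleGraph (Fin n)) :
    PreAbstractSimplicialComplex (Finset (Fin n)) where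
  faces := {c | c.Nonempty ∧ (∀ S ∈ c, S.Nonempty ∧ S ≠ Finset.univ) ∧
    IsChain (· ⊆ ·) (c : Set (Finset (Fin n))) ∧
    ∃ i j, G.Adj i j ∧ ∀ S ∈ c, (i ∈ S ↔ j ∈ S)}
  isRelLowerSet_faces := by
    rintro c ⟨hc, h₁, h₂, i, j, hij, h₃⟩
    exact ⟨hc, fun t ht hne => ⟨hne, fun S hS => h₁ S (ht hS),
      h₂.mono (Finset.coe_subset.2 ht), i, j, hij, fun S hS => h₃ S (ht hS)⟩⟩

end Graphs

end HypArr

/-! The facets are the open cells of the hyperplanes in $\mathcal A$. Number these hyperplanes.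
Within each one, `a`, the earlier hyperplanes of $\mathcal A$ cut out regions, and in every region a
base cell is chosen. Facets are ranked by the number of their hyperplane, and then by how many
hyperplanes of $\mathcal H$ give them the same sign as the base cell of their region, the fewest
agreements first.

To verify the exchange property, expand a point `b` of the base cell of `σ` as `∑ β v • v` over the
vertices of `σ`. These vertices are a basis of `a`, because $\mathcal H$ is simplicial
(`linearIndepOn_pt`, `span_vertices_of_isGenericIn`). Let `s` be a common face of `σ` and a facet
`τ` of no larger rank.

If `0 ≤ β m` for a vertex `m` outside `s`, the wall opposite `m` lies in a facet of smaller rank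
(`exists_rank_lt`): either it lies in an earlier hyperplane of $\mathcal A$, or crossing it leads
away from the base cell inside the same region.

Otherwise every coordinate outside `s` is negative, so each hyperplane other than `a` through `s`
separates `σ` from `b`. Every hyperplane on which `τ` and `σ` differ contains `s`. Hence `τ` can lie
neither in an earlier hyperplane nor in another region of `a`, and within the same region it agrees
with the base cell strictly more often than `σ` does, contradicting the choice of `τ`.

For the braid arrangement, a cell corresponds to the chain of sets on which the coordinates exceed
all the others. This gives simpliciality, and it carries the shelling over to the coloring complex.
-/

namespace HypArr

/-! ### Shellings from a ranking with an exchange property. -/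

section Shelling

variable {ι α β : Type*}

/-- A finite family of nonempty sets of size `d`, distinct for distinct indices, together with a
ranking of the indices along which every set satisfies the exchange property of shellings. -/
structure IsShellingFamily (F : ι → Finset α) (d : ℕ) (key : ι → ℕ ×ₗ ℕ) : Prop where
  finite : Finite ι
  injective : Function.Injective F
  nonempty : ∀ i, (F i).Nonempty
  card_eq : ∀ i, (F i).card = d
  exchange : ∀ i j, i ≠ j → key j ≤ key i → ∀ s ⊆ F i, s ⊆ F j →
    ∃ v ∈ F i, v ∉ s ∧ ∃ l, key l < key i ∧ ∀ w ∈ F i, w ≠ v → w ∈ F l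

/-- Ties in `key` may be broken arbitrarily: the exchange property assumes only a weak inequality
and yields a strict one, so every sorting of the indices by `key` is a shelling order. -/
theorem IsShellingFamily.shellable {F : ι → Finset α} {d : ℕ} {key : ι → ℕ ×ₗ ℕ}
    (hF : IsShellingFamily F d key) {K : PreAbstractSimplicialComplex α}
    (hK : ∀ s, s ∈ K.faces ↔ s.Nonempty ∧ ∃ i, s ⊆ F i) : Shellable K := by
  classical
  have := hF.finite
  have hmem : ∀ i, F i ∈ K.faces := fun i => (hK _).2 ⟨hF.nonempty i, i, subset_rfl⟩
  have hfacets : facets K = Set.range F := by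
    ext s
    constructor
    · intro hs
      obtain ⟨-, i, hi⟩ := (hK s).1 hs.1
      exact ⟨i, (hs.eq_of_le (hmem i) hi).symm⟩
    · rintro ⟨i, rfl⟩
      refine ⟨hmem i, fun s hs his => ?_⟩
      obtain ⟨-, j, hj⟩ := (hK s).1 hs
      have hij : F i = F j := Finset.eq_of_subset_of_card_le (his.trans hj)
        (by rw [hF.card_eq, hF.card_eq])
      exact hij ▸ hj
  refine ⟨?_, d, ?_, ?_⟩
  · refine (Set.finite_iUnion fun i => (F i).powerset.finite_toSet).subset fun s hs => ?_
    obtain ⟨-, i, hi⟩ := (hK s).1 hs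
    exact Set.mem_iUnion.2 ⟨i, by simpa using hi⟩
  · intro s hs
    obtain ⟨i, rfl⟩ : s ∈ Set.range F := hfacets ▸ hs
    exact hF.card_eq i
  · obtain ⟨t, ⟨e⟩⟩ := Finite.exists_equiv_fin ι
    set π := Tuple.sort (key ∘ e.symm) with hπ
    have hmono : Monotone (key ∘ e.symm ∘ π) := Tuple.monotone_sort (key ∘ e.symm)
    refine ⟨t, F ∘ e.symm ∘ π, hF.injective.comp (e.symm.injective.comp π.injective), ?_, ?_⟩
    · rw [hfacets, (e.symm.surjective.comp π.surjective).range_comp]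
    · intro j _
      have hd : 0 < d := hF.card_eq (e.symm (π j)) ▸ (hF.nonempty _).card_pos
      refine ⟨d - 1, by omega, ?_⟩
      rintro s ⟨⟨hsj, i, hij, hsi⟩, hmax⟩
      obtain ⟨v, hv, hvs, l, hl, hvl⟩ := hF.exchange (e.symm (π j)) (e.symm (π i))
        (fun h => hij.ne' (π.injective (e.symm.injective h))) (hmono hij.le) s hsj hsi
      obtain ⟨m, rfl⟩ := (e.symm.surjective.comp π.surjective) l
      have hmj : m < j := by
        by_contra h
        exact absurd (hmono (not_lt.1 h)) (not_le.2 hl)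
      -- The facet minus `v` contains `s` and belongs to the intersection, so a maximal `s` equals
      -- it and has codimension one.
      have hsub : s ⊆ (F (e.symm (π j))).erase v := fun w hw =>
        Finset.mem_erase.2 ⟨fun h => hvs (h ▸ hw), hsj hw⟩
      have hle := hmax (y := (F (e.symm (π j))).erase v) ⟨Finset.erase_subset _ _, m, hmj,
        fun w hw => hvl w (Finset.mem_of_mem_erase hw) (Finset.ne_of_mem_erase hw)⟩ hsub
      rw [Finset.Subset.antisymm hsub hle, Finset.card_erase_of_mem hv, hF.card_eq]

/-- Renaming vertices injectively preserves the property. It carries the shelling from cells as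
vertices to subsets of `[n]` as vertices. -/
theorem IsShellingFamily.of_image {F : ι → Finset α} {d : ℕ} {key : ι → ℕ ×ₗ ℕ}
    (hF : IsShellingFamily F d key) {f : α → β} {F' : ι → Finset β} {M : Set α}
    (hf : Set.InjOn f M) (hM : ∀ i, (F i : Set α) ⊆ M)
    (hF' : ∀ i w, w ∈ F' i ↔ ∃ v ∈ F i, f v = w) : IsShellingFamily F' d key := by
  classical
  have himg : ∀ i, F' i = (F i).image f := fun i => by
    ext w
    simp [hF']
  have hmem : ∀ i, ∀ v ∈ M, f v ∈ F' i ↔ v ∈ F i := fun i v hv => by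
    rw [hF']
    constructor
    · rintro ⟨u, hu, huv⟩
      exact hf (hM i hu) hv huv ▸ hu
    · exact fun h => ⟨v, h, rfl⟩
  refine ⟨hF.finite, ?_, ?_, ?_, ?_⟩
  · intro i j hij
    refine hF.injective (Finset.ext fun v => ⟨fun h => ?_, fun h => ?_⟩)
    · rw [← hmem j v (hM i h), ← hij, hmem i v (hM i h)]
      exact h
    · rw [← hmem i v (hM j h), hij, hmem j v (hM j h)]
      exact h
  · intro i
    rw [himg]
    exact (hF.nonempty i).image f
  · intro i
    rw [himg, Finset.card_image_of_injOn (hf.mono (hM i)), hF.card_eq]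
  · intro i j hij hkey s hsi hsj
    obtain ⟨v, hv, hvs, l, hl, hvl⟩ := hF.exchange i j hij hkey ((F i).filter fun v => f v ∈ s)
      (Finset.filter_subset _ _) (fun v hv => by
        rw [Finset.mem_filter] at hv
        exact (hmem j v (hM i hv.1)).1 (hsj hv.2))
    refine ⟨f v, (hmem i v (hM i hv)).2 hv, fun h => hvs (Finset.mem_filter.2 ⟨hv, h⟩), l, hl, ?_⟩
    intro w hw hwv
    obtain ⟨u, hu, rfl⟩ := (hF' i w).1 hw
    exact (hF' l _).2 ⟨u, hvl u hu (fun h => hwv (h ▸ rfl)), rfl⟩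

end Shelling

end HypArr

namespace HypArr

/-! ### Closed cones of cells and small perturbations. -/

section Cones

variable {V : Type*} [NormedAddCommGroup V] [InnerProductSpace ℝ V] {H : Set (Submodule ℝ V)}

theorem signVector_smul_of_pos {c : ℝ} (hc : 0 < c) (p : V) :
    signVector H (c • p) = signVector H p := by
  funext h
  simp [signVector, sign_mul, sign_pos hc]

/-- The cell through which the ray of a nonzero vector passes. -/
noncomputable def Cell.ofPoint (H : Set (Submodule ℝ V)) (p : V) (hp : p ≠ 0) : Cell H :=
  ⟨signVector H p, ‖p‖⁻¹ • p, by simp [norm_smul, hp],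
    signVector_smul_of_pos (inv_pos.2 (norm_pos_iff.2 hp)) p⟩

/-- A point of a cell. -/
noncomputable def Cell.pt (σ : Cell H) : V := σ.2.choose

theorem Cell.signVector_pt (σ : Cell H) : signVector H σ.pt = σ.1 := σ.2.choose_spec.2

theorem Cell.sign_pt (σ : Cell H) (h : H) : SignType.sign (orientation h.1 σ.pt) = σ.1 h :=
  congrFun σ.signVector_pt h

theorem Cell.apply_pt_eq_zero_iff (σ : Cell H) (h : H) :
    orientation h.1 σ.pt = 0 ↔ σ.1 h = 0 := by
  rw [← σ.sign_pt, sign_eq_zero_iff]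

theorem Cell.pt_ne_zero (σ : Cell H) : σ.pt ≠ 0 :=
  ne_zero_of_mem_unit_sphere (⟨σ.pt, σ.2.choose_spec.1⟩ : Metric.sphere (0 : V) 1)

/-- The closed cone spanned by a cell. -/
def Cell.cone (σ : Cell H) : Set V :=
  {p | ∀ h, signVector H p h = 0 ∨ signVector H p h = σ.1 h}

theorem Cell.pt_mem_cone {σ τ : Cell H} : σ.pt ∈ τ.cone ↔ σ ≤ τ := by
  change (∀ h, signVector H σ.pt h = 0 ∨ signVector H σ.pt h = τ.1 h) ↔ _
  rw [σ.signVector_pt]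
  rfl

theorem Cell.mem_cone_iff {σ : Cell H} {p : V} : p ∈ σ.cone ↔
    ∀ h, 0 ≤ (σ.1 h : ℝ) * orientation h.1 p ∧ (σ.1 h = 0 → orientation h.1 p = 0) := by
  refine forall_congr' fun h => ?_
  change SignType.sign (orientation h.1 p) = 0 ∨ SignType.sign (orientation h.1 p) = σ.1 h ↔ _
  rcases lt_trichotomy (orientation h.1 p) 0 with hlt | heq | hgt
  · rw [sign_neg hlt]
    cases σ.1 h <;> simp [hlt.le, hlt.ne, hlt]
  · simp [heq]
  · rw [sign_pos hgt]
    cases σ.1 h <;> simp [hgt.le, hgt.ne', hgt]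

theorem Cell.apply_eq_zero_iff_of_mem_cone {σ : Cell H} {p : V} (hp : p ∈ σ.cone) (h : H) :
    orientation h.1 p = 0 ↔ (σ.1 h : ℝ) * orientation h.1 p = 0 := by
  have h2 := (Cell.mem_cone_iff.1 hp h).2
  rw [mul_eq_zero]
  refine ⟨Or.inr, fun hor => hor.elim (fun h0 => h2 ?_) id⟩
  revert h0
  cases σ.1 h <;> simp

section Sums

variable {ι : Type*} {σ : Cell H} {t : Finset ι} {p : ι → V} {c : ι → ℝ}

theorem Cell.sum_mem_cone (hp : ∀ i ∈ t, p i ∈ σ.cone) (hc : ∀ i ∈ t, 0 ≤ c i) :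
    ∑ i ∈ t, c i • p i ∈ σ.cone := by
  rw [Cell.mem_cone_iff]
  intro h
  have hp' := fun i hi => Cell.mem_cone_iff.1 (hp i hi) h
  simp only [map_sum, map_smul, smul_eq_mul, Finset.mul_sum]
  constructor
  · refine Finset.sum_nonneg fun i hi => ?_
    rw [mul_left_comm]
    exact mul_nonneg (hc i hi) (hp' i hi).1
  · exact fun h0 => Finset.sum_eq_zero fun i hi => by rw [(hp' i hi).2 h0, mul_zero]

/-- On a closed cone each functional has a constant weak sign, so the terms of a positive
combination cannot cancel. -/
theorem Cell.apply_sum_eq_zero_iff (hp : ∀ i ∈ t, p i ∈ σ.cone) (hc : ∀ i ∈ t, 0 < c i) (h : H) :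
    orientation h.1 (∑ i ∈ t, c i • p i) = 0 ↔ ∀ i ∈ t, orientation h.1 (p i) = 0 := by
  rw [Cell.apply_eq_zero_iff_of_mem_cone (Cell.sum_mem_cone hp fun i hi => (hc i hi).le)]
  simp only [map_sum, map_smul, smul_eq_mul, Finset.mul_sum]
  rw [Finset.sum_eq_zero_iff_of_nonneg]
  · refine forall₂_congr fun i hi => ?_
    rw [Cell.apply_eq_zero_iff_of_mem_cone (hp i hi), mul_left_comm, mul_eq_zero]
    simp [(hc i hi).ne']
  · intro i hi
    rw [mul_left_comm]
    exact mul_nonneg (hc i hi).le (Cell.mem_cone_iff.1 (hp i hi) h).1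

end Sums

theorem exists_pos_sign_add_smul_eq (hH : H.Finite) (p b : V) : ∃ ε : ℝ, 0 < ε ∧
    ∀ h : H, orientation h.1 p ≠ 0 → signVector H (p + ε • b) h = signVector H p h := by
  have := hH.to_subtype
  have hev : ∀ᶠ ε in nhdsWithin (0 : ℝ) (Set.Ioi 0), ∀ h : H, orientation h.1 p ≠ 0 →
      signVector H (p + ε • b) h = signVector H p h := by
    refine Filter.eventually_all.2 fun h => nhdsWithin_le_nhds ?_
    have hcont : Continuous fun ε : ℝ => orientation h.1 p + ε * orientation h.1 b := by fun_prop
    have htend := hcont.tendsto 0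
    rw [zero_mul, add_zero] at htend
    rcases lt_trichotomy (orientation h.1 p) 0 with hlt | heq | hgt
    · filter_upwards [htend.eventually_lt_const hlt] with ε hε _
      simp only [signVector, map_add, map_smul, smul_eq_mul]
      rw [sign_neg hε, sign_neg hlt]
    · exact Filter.Eventually.of_forall fun ε hne => (hne heq).elim
    · filter_upwards [htend.eventually_const_lt hgt] with ε hε _
      simp only [signVector, map_add, map_smul, smul_eq_mul]
      rw [sign_pos hε, sign_pos hgt]
  obtain ⟨ε, hε, hpos⟩ := (hev.and self_mem_nhdsWithin).exists
  exact ⟨ε, hpos, hε⟩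

theorem finite_cell (hH : H.Finite) : Finite (Cell H) := by
  have := hH.to_subtype
  exact inferInstanceAs (Finite {σ : H → SignType // _})

/-- The vertices of a cell as a finite set. -/
noncomputable def Cell.vertexFinset [Finite (Cell H)] (σ : Cell H) : Finset (Cell H) :=
  (Set.toFinite σ.vertices).toFinset

@[simp] theorem Cell.mem_vertexFinset [Finite (Cell H)] {σ v : Cell H} :
    v ∈ σ.vertexFinset ↔ v ∈ σ.vertices := Set.Finite.mem_toFinset _

theorem Cell.vertices_mono {σ τ : Cell H} (h : σ ≤ τ) : σ.vertices ⊆ τ.vertices :=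
  fun _ hv => ⟨hv.1, hv.2.trans h⟩

end Cones

/-! ### Vertices of a cell: spanning and linear independence. -/

namespace IsSimplicialArrangement

variable {V : Type*} [NormedAddCommGroup V] [InnerProductSpace ℝ V] {H : Set (Submodule ℝ V)}
  (hH : IsSimplicialArrangement H)

include hH

theorem mem_iff (h : H) (p : V) : p ∈ h.1 ↔ orientation h.1 p = 0 := by
  rw [← LinearMap.mem_ker, ker_orientation (hH.hyperplane _ h.2)]

theorem exists_apply_ne_zero {p : V} (hp : p ≠ 0) : ∃ h : H, orientation h.1 p ≠ 0 := by
  by_contra! hcon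
  have : p ∈ sInf H := (Submodule.mem_sInf).2 fun h hh => (hH.mem_iff ⟨h, hh⟩ p).2 (hcon ⟨h, hh⟩)
  rw [hH.essential] at this
  exact hp ((Submodule.mem_bot ℝ).1 this)

theorem eq_of_vertices_eq {σ τ : Cell H} (h : σ.vertices = τ.vertices) : σ = τ :=
  le_antisymm (hH.le_of_vertices_subset _ _ h.le) (hH.le_of_vertices_subset _ _ h.ge)

/-- The face of a cell with a given nonempty set of vertices is the cell of every positive
combination of these vertices. -/
theorem exists_cell_of_sum {σ : Cell H} {t : Finset (Cell H)} (ht : (t : Set (Cell H)) ⊆ σ.vertices)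
    (hne : t.Nonempty) {c : Cell H → ℝ} (hc : ∀ v ∈ t, 0 < c v) :
    ∃ τ : Cell H, τ.vertices = t ∧ τ ≤ σ ∧ signVector H (∑ v ∈ t, c v • v.pt) = τ.1 := by
  obtain ⟨τ, hτ⟩ := hH.exists_vertices_eq σ t ht (by simpa using hne)
  have hmem : ∀ v ∈ t, v.pt ∈ τ.cone := fun v hv => by
    have hv' : v ∈ τ.vertices := hτ ▸ hv
    exact Cell.pt_mem_cone.2 hv'.2
  have hx := Cell.sum_mem_cone hmem fun v hv => (hc v hv).le
  have hzero := Cell.apply_sum_eq_zero_iff hmem hc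
  set x := ∑ v ∈ t, c v • v.pt
  have hx0 : x ≠ 0 := by
    rintro hx0
    obtain ⟨v, hv⟩ := hne
    obtain ⟨h, hh⟩ := hH.exists_apply_ne_zero v.pt_ne_zero
    exact hh ((hzero h).1 (by rw [hx0, map_zero]) v hv)
  have hle : Cell.ofPoint H x hx0 ≤ τ := hx
  -- By simpliciality it is enough to compare vertices. Where a vertex in `t` is nonzero, `x` is
  -- nonzero too, since nothing cancels, and both carry the sign of `τ`.
  have hge : τ ≤ Cell.ofPoint H x hx0 := by
    refine hH.le_of_vertices_subset _ _ fun v hv => ⟨hv.1, fun h => ?_⟩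
    have hvt : v ∈ t := by rw [hτ] at hv; exact hv
    by_cases h0 : v.1 h = 0
    · exact Or.inl h0
    · refine Or.inr ?_
      have hxh : (Cell.ofPoint H x hx0).1 h ≠ 0 := fun hx' => h0 <| by
        rw [← v.apply_pt_eq_zero_iff]
        exact (hzero h).1 (sign_eq_zero_iff.1 hx') v hvt
      rw [(hle h).resolve_left hxh, (hv.2 h).resolve_left h0]
  have heq : Cell.ofPoint H x hx0 = τ := le_antisymm hle hge
  exact ⟨τ, hτ, hH.le_of_vertices_subset _ _ (hτ ▸ ht), congrArg Subtype.val heq⟩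

theorem signVector_sum_vertices [Finite (Cell H)] (σ : Cell H) :
    signVector H (∑ v ∈ σ.vertexFinset, v.pt) = σ.1 := by
  obtain ⟨v, hv⟩ := hH.vertices_nonempty σ
  obtain ⟨τ, hτ, -, hs⟩ := hH.exists_cell_of_sum (σ := σ) (t := σ.vertexFinset)
    (by simp [Cell.vertexFinset]) ⟨v, Cell.mem_vertexFinset.2 hv⟩ (c := fun _ => 1) (by simp)
  simp only [one_smul] at hs
  rw [hs, hH.eq_of_vertices_eq (hτ.trans (by simp [Cell.vertexFinset] : _ = σ.vertices))]

/-- Induction on faces: subtracting from `q` the largest multiple of a vertex that stays in the cone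
gives zero or a point of a proper face. -/
theorem cone_subset_span (σ : Cell H) :
    σ.cone ⊆ Submodule.span ℝ (Cell.pt '' σ.vertices) := by
  have := finite_cell hH.finite
  have := hH.finite.to_subtype
  induction σ using WellFoundedLT.induction with
  | ind σ ih =>
  have key : ∀ q ∈ σ.cone, signVector H q ≠ σ.1 →
      q ∈ Submodule.span ℝ (Cell.pt '' σ.vertices) := by
    intro q hq hne
    by_cases hq0 : q = 0
    · rw [hq0]
      exact zero_mem _
    · have hlt : Cell.ofPoint H q hq0 < σ :=
        lt_of_le_of_ne hq fun h => hne (congrArg Subtype.val h)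
      exact Submodule.span_mono (Set.image_mono (Cell.vertices_mono hlt.le))
        (ih _ hlt fun h => Or.inr rfl)
  intro q hq
  by_cases hne : signVector H q = σ.1
  swap
  · exact key q hq hne
  obtain ⟨v, hv⟩ := hH.vertices_nonempty σ
  have hvc := Cell.mem_cone_iff.1 (Cell.pt_mem_cone.2 hv.2)
  have hqc := Cell.mem_cone_iff.1 hq
  have hS : (Set.toFinite {h : H | orientation h.1 v.pt ≠ 0}).toFinset.Nonempty := by
    obtain ⟨h, hh⟩ := hH.exists_apply_ne_zero v.pt_ne_zero
    exact ⟨h, by simpa using hh⟩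
  obtain ⟨h₀, hh₀, hmin⟩ := Finset.exists_min_image _
    (fun h : H => orientation h.1 q / orientation h.1 v.pt) hS
  simp only [Set.Finite.mem_toFinset, Set.mem_ofPred_eq] at hh₀ hmin
  -- The smallest ratio is the first moment at which `q - r • v.pt` meets a hyperplane not
  -- containing `v`.
  set r := orientation h₀.1 q / orientation h₀.1 v.pt with hr
  have hq' : q - r • v.pt ∈ σ.cone := by
    refine Cell.mem_cone_iff.2 fun h => ⟨?_, fun h0 => ?_⟩
    · simp only [map_sub, map_smul, smul_eq_mul]
      by_cases hvh : orientation h.1 v.pt = 0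
      · simpa [hvh] using (hqc h).1
      · have h1 := hmin h hvh
        have h2 : 0 < (σ.1 h : ℝ) * orientation h.1 v.pt := lt_of_le_of_ne (hvc h).1
          fun h0 => hvh ((Cell.apply_eq_zero_iff_of_mem_cone
            (Cell.pt_mem_cone.2 hv.2) h).2 h0.symm)
        have h3 : orientation h.1 q
            = orientation h.1 q / orientation h.1 v.pt * orientation h.1 v.pt := by
          field_simp
        rw [h3]
        nlinarith [mul_nonneg (sub_nonneg.2 h1) h2.le]
    · simp [(hqc h).2 h0, (hvc h).2 h0]
  have hmem := key _ hq' fun heq => by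
    have h1 : σ.1 h₀ = 0 := by
      rw [← heq]
      simp [signVector, hr, hh₀]
    exact hh₀ ((hvc h₀).2 h1)
  have hvs : v.pt ∈ Submodule.span ℝ (Cell.pt '' σ.vertices) :=
    Submodule.subset_span ⟨v, hv, rfl⟩
  simpa using add_mem hmem (Submodule.smul_mem _ r hvs)

/-- Separating the positive from the negative coefficients of a relation gives one point as a
positive combination of two disjoint vertex sets. Its cell would have both as its vertex set. -/
theorem linearIndepOn_pt [Finite (Cell H)] (σ : Cell H) :
    LinearIndepOn ℝ Cell.pt (σ.vertexFinset : Set (Cell H)) := by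
  classical
  rw [linearIndepOn_finset_iff]
  have key : ∀ g : Cell H → ℝ, ∑ v ∈ σ.vertexFinset, g v • v.pt = 0 →
      ∀ v ∈ σ.vertexFinset, g v ≤ 0 := by
    intro g hg v hv
    by_contra! hpos
    set I := σ.vertexFinset.filter fun v => 0 < g v with hI
    set J := σ.vertexFinset.filter fun v => g v < 0 with hJ
    have hvI : v ∈ I := by simp only [hI, Finset.mem_filter]; exact ⟨hv, hpos⟩
    have hIσ : (I : Set (Cell H)) ⊆ σ.vertices := fun u hu =>
      Cell.mem_vertexFinset.1 (Finset.mem_filter.1 hu).1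
    have hJσ : (J : Set (Cell H)) ⊆ σ.vertices := fun u hu =>
      Cell.mem_vertexFinset.1 (Finset.mem_filter.1 hu).1
    have hsum : ∑ u ∈ I, g u • u.pt = ∑ u ∈ J, (-g u) • u.pt := by
      rw [← sub_eq_zero, ← hg, hI, hJ, Finset.sum_filter, Finset.sum_filter,
        ← Finset.sum_sub_distrib]
      refine Finset.sum_congr rfl fun u _ => ?_
      rcases lt_trichotomy (g u) 0 with h | h | h
      · simp [h, h.le]
      · simp [h]
      · simp [h, h.le]
    obtain ⟨τ, hτ, -, hτs⟩ := hH.exists_cell_of_sum hIσ ⟨v, hvI⟩ (c := g)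
      fun u hu => (Finset.mem_filter.1 hu).2
    rcases J.eq_empty_or_nonempty with hJe | hJne
    · rw [hsum, hJe, Finset.sum_empty] at hτs
      obtain ⟨h, hh⟩ := hH.exists_apply_ne_zero τ.pt_ne_zero
      refine hh ((τ.apply_pt_eq_zero_iff h).2 ?_)
      rw [← hτs]
      simp [signVector]
    · obtain ⟨ρ, hρ, -, hρs⟩ := hH.exists_cell_of_sum hJσ hJne (c := fun u => -g u)
        fun u hu => neg_pos.2 (Finset.mem_filter.1 hu).2
      have hτρ : τ = ρ := Subtype.ext (by rw [← hτs, ← hρs, hsum])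
      have hvJ : v ∈ (J : Set (Cell H)) := by rw [← hρ, ← hτρ, hτ]; exact hvI
      exact absurd (Finset.mem_filter.1 hvJ).2 hpos.not_gt
  intro g hg v hv
  refine le_antisymm (key g hg v hv) ?_
  have := key (fun u => -g u) (by simp [hg]) v hv
  linarith

end IsSimplicialArrangement

end HypArr

namespace HypArr

/-! ### Open cells of a hyperplane, their walls and neighbours. -/

section Generic

variable {V : Type*} [NormedAddCommGroup V] [InnerProductSpace ℝ V]

/-- `σ` is an open cell of the hyperplane `a`: `a` is the only hyperplane of `H` containing it. -/
def Cell.IsGenericIn {H : Set (Submodule ℝ V)} (σ : Cell H) (a : Submodule ℝ V) : Prop :=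
  ∀ h : H, σ.1 h = 0 ↔ h.1 = a

/-- A real vector space is not a finite union of proper subspaces. -/
theorem exists_mem_forall_notMem {H : Set (Submodule ℝ V)} (hfin : H.Finite)
    (hco : ∀ h ∈ H, IsCoatom h) {a : Submodule ℝ V} (ha : IsCoatom a) :
    ∃ r ∈ a, ∀ h ∈ H, h ≠ a → r ∉ h := by
  classical
  have hne := Subspace.biUnion_ne_univ_of_top_notMem (k := ℝ) (E := a)
    (s := (hfin.toFinset.erase a).image fun h => h.comap a.subtype) (by
      rw [Finset.mem_image]
      rintro ⟨h, hh, htop⟩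
      rw [Finset.mem_erase, Set.Finite.mem_toFinset] at hh
      rw [Submodule.comap_subtype_eq_top] at htop
      exact hh.1 ((ha.le_iff.1 htop).resolve_left (hco h hh.2).1))
  obtain ⟨r, hr⟩ := (Set.ne_univ_iff_exists_notMem _).1 hne
  refine ⟨r.1, r.2, fun h hh hha hrh => hr ?_⟩
  refine Set.mem_iUnion₂.2 ⟨h.comap a.subtype, Finset.mem_image.2 ⟨h, ?_, rfl⟩, hrh⟩
  rw [Finset.mem_erase, Set.Finite.mem_toFinset]
  exact ⟨hha, hh⟩

theorem Cell.apply_sum_vertices_eq_zero_iff {H : Set (Submodule ℝ V)} [Finite (Cell H)]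
    {σ : Cell H} {t : Finset (Cell H)} (ht : t ⊆ σ.vertexFinset) (h : H) :
    orientation h.1 (∑ v ∈ t, v.pt) = 0 ↔ ∀ v ∈ t, orientation h.1 v.pt = 0 := by
  have := Cell.apply_sum_eq_zero_iff (σ := σ) (t := t) (p := Cell.pt) (c := fun _ => 1)
    (fun v hv => Cell.pt_mem_cone.2 (Cell.mem_vertexFinset.1 (ht hv)).2) (by simp) h
  simpa using this

end Generic

namespace IsSimplicialArrangement

variable {V : Type*} [NormedAddCommGroup V] [InnerProductSpace ℝ V] {H : Set (Submodule ℝ V)}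
  (hH : IsSimplicialArrangement H)

include hH

/-- Every point of a hyperplane lies on the boundary of an open cell of it. -/
theorem exists_isGenericIn {a : Submodule ℝ V} (haH : a ∈ H) (ha : a ≠ ⊥) {q : V} (hq : q ∈ a) :
    ∃ σ : Cell H, σ.IsGenericIn a ∧ q ∈ σ.cone := by
  obtain ⟨r, hra, hr⟩ := exists_mem_forall_notMem hH.finite hH.hyperplane (hH.hyperplane a haH)
  obtain ⟨ε, hε, hsign⟩ := exists_pos_sign_add_smul_eq hH.finite q r
  have hxa : q + ε • r ∈ a := a.add_mem hq (a.smul_mem _ hra)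
  have hx : ∀ h : H, signVector H (q + ε • r) h = 0 ↔ h.1 = a := by
    intro h
    constructor
    · intro h0
      by_contra hne
      by_cases hqh : orientation h.1 q = 0
      · have : orientation h.1 (q + ε • r) = 0 := sign_eq_zero_iff.1 h0
        rw [map_add, hqh, zero_add, map_smul, smul_eq_mul, mul_eq_zero] at this
        exact hr h.1 h.2 hne ((hH.mem_iff h r).2 (this.resolve_left hε.ne'))
      · rw [hsign h hqh] at h0
        exact hqh (sign_eq_zero_iff.1 h0)
    · rintro rfl
      exact sign_eq_zero_iff.2 ((hH.mem_iff h _).1 hxa)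
  -- If the perturbed point were `0`, every member of `H` would equal `a`, contradicting
  -- essentiality because `a ≠ ⊥`.
  have hx0 : q + ε • r ≠ 0 := by
    intro hx0
    obtain ⟨p, hpa, hp0⟩ := (Submodule.ne_bot_iff a).1 ha
    obtain ⟨h, hh⟩ := hH.exists_apply_ne_zero hp0
    have h1 : h.1 = a := (hx h).1 (by simp [hx0, signVector])
    exact hh ((hH.mem_iff h p).1 (h1 ▸ hpa))
  refine ⟨Cell.ofPoint H _ hx0, hx, fun h => ?_⟩
  by_cases hqh : orientation h.1 q = 0
  · exact Or.inl (sign_eq_zero_iff.2 hqh)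
  · exact Or.inr (hsign h hqh).symm

variable {a : Submodule ℝ V} {σ : Cell H}

theorem pt_mem_of_isGenericIn (haH : a ∈ H) (hσ : σ.IsGenericIn a) : σ.pt ∈ a :=
  (hH.mem_iff ⟨a, haH⟩ _).2 ((σ.apply_pt_eq_zero_iff _).2 ((hσ ⟨a, haH⟩).2 rfl))

/-- The cone of a generic cell has nonempty interior relative to `a`: moving slightly from `σ.pt` in
any direction of `a` stays in it. Together with `linearIndepOn_pt` this makes the vertices a basis
of `a`, whence purity. -/
theorem span_vertices_of_isGenericIn (haH : a ∈ H) (hσ : σ.IsGenericIn a) :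
    Submodule.span ℝ (Cell.pt '' σ.vertices) = a := by
  refine le_antisymm (Submodule.span_le.2 ?_) fun b hb => ?_
  · rintro _ ⟨v, hv, rfl⟩
    refine (hH.mem_iff ⟨a, haH⟩ _).2 ((v.apply_pt_eq_zero_iff _).2 ?_)
    have h0 := (hσ ⟨a, haH⟩).2 rfl
    exact (hv.2 ⟨a, haH⟩).elim id fun e => e.trans h0
  · obtain ⟨ε, hε, hsign⟩ := exists_pos_sign_add_smul_eq hH.finite σ.pt b
    have h1 : σ.pt ∈ Submodule.span ℝ (Cell.pt '' σ.vertices) :=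
      hH.cone_subset_span σ (Cell.pt_mem_cone.2 le_rfl)
    have h2 : σ.pt + ε • b ∈ Submodule.span ℝ (Cell.pt '' σ.vertices) := by
      refine hH.cone_subset_span σ fun h => ?_
      by_cases hh : orientation h.1 σ.pt = 0
      · have hha : h.1 = a := (hσ h).1 ((σ.apply_pt_eq_zero_iff h).1 hh)
        refine Or.inl (sign_eq_zero_iff.2 ?_)
        rw [map_add, hh, map_smul, (hH.mem_iff h b).1 (hha ▸ hb), smul_zero, add_zero]
      · exact Or.inr ((hsign h hh).trans (σ.sign_pt h))
    have h3 : ε • b ∈ Submodule.span ℝ (Cell.pt '' σ.vertices) := by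
      simpa using sub_mem h2 h1
    exact (Submodule.smul_mem_iff _ hε.ne').1 h3

variable [Finite (Cell H)]

theorem card_vertexFinset_of_isGenericIn (haH : a ∈ H) (hσ : σ.IsGenericIn a) :
    σ.vertexFinset.card = Module.finrank ℝ a := by
  have hspan := hH.span_vertices_of_isGenericIn haH hσ
  have h := finrank_span_eq_card (hH.linearIndepOn_pt σ).linearIndependent
  have hr : (Set.range fun v : (σ.vertexFinset : Set (Cell H)) => v.1.pt)
      = Cell.pt '' σ.vertices := by
    ext x
    simp
  rw [hr, hspan] at h
  rw [h]
  simp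

theorem exists_sum_eq_of_isGenericIn (haH : a ∈ H) (hσ : σ.IsGenericIn a) {b : V} (hb : b ∈ a) :
    ∃ β : Cell H → ℝ, ∑ v ∈ σ.vertexFinset, β v • v.pt = b := by
  classical
  rw [← hH.span_vertices_of_isGenericIn haH hσ] at hb
  have hc : Cell.pt '' σ.vertices = Cell.pt '' (σ.vertexFinset : Set (Cell H)) := by
    simp [Cell.vertexFinset]
  rw [hc, Submodule.mem_span_image_finset_iff_exists_fun] at hb
  obtain ⟨c, hc⟩ := hb
  refine ⟨fun v => if hv : v ∈ σ.vertexFinset then c ⟨v, hv⟩ else 0, ?_⟩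
  rw [← hc, ← Finset.sum_coe_sort]
  refine Finset.sum_congr rfl fun v _ => ?_
  simp

/-- A wall of a cell lies in a hyperplane not containing the opposite vertex. -/
theorem exists_wall {m : Cell H} (hm : m ∈ σ.vertexFinset) :
    ∃ h : H, (∀ v ∈ σ.vertexFinset, v ≠ m → orientation h.1 v.pt = 0) ∧
      orientation h.1 m.pt ≠ 0 := by
  classical
  rcases (σ.vertexFinset.erase m).eq_empty_or_nonempty with he | hne
  · obtain ⟨h, hh⟩ := hH.exists_apply_ne_zero m.pt_ne_zero
    refine ⟨h, fun v hv hvm => ?_, hh⟩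
    have : v ∈ σ.vertexFinset.erase m := Finset.mem_erase.2 ⟨hvm, hv⟩
    simp [he] at this
  · obtain ⟨τ, hτ, hle, hs⟩ := hH.exists_cell_of_sum (σ := σ) (t := σ.vertexFinset.erase m)
      (fun v hv => Cell.mem_vertexFinset.1 (Finset.mem_of_mem_erase hv)) hne
      (c := fun _ => 1) (by simp)
    simp only [one_smul] at hs
    -- The wall `τ` is a proper face, so some hyperplane contains it but not `σ`.
    obtain ⟨h, hh⟩ : ∃ h, τ.1 h ≠ σ.1 h := by
      by_contra! hcon
      have hmτ : m ∈ τ.vertices := by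
        rw [Subtype.ext (funext hcon : τ.1 = σ.1)]
        exact Cell.mem_vertexFinset.1 hm
      rw [hτ] at hmτ
      simp at hmτ
    have h0 : τ.1 h = 0 := (hle h).resolve_right hh
    have hz : ∀ v ∈ σ.vertexFinset.erase m, orientation h.1 v.pt = 0 := by
      rw [← Cell.apply_sum_vertices_eq_zero_iff (Finset.erase_subset _ _) h, ← sign_eq_zero_iff,
        ← h0, ← hs]
      rfl
    refine ⟨h, fun v hv hvm => hz v (Finset.mem_erase.2 ⟨hvm, hv⟩), fun hm0 => hh ?_⟩
    rw [h0, ← hH.signVector_sum_vertices σ]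
    refine (sign_eq_zero_iff.2 ?_).symm
    rw [Cell.apply_sum_vertices_eq_zero_iff subset_rfl]
    intro v hv
    by_cases hvm : v = m
    · rw [hvm, hm0]
    · exact hz v (Finset.mem_erase.2 ⟨hvm, hv⟩)

theorem sign_eq_of_wall {m : Cell H} (hm : m ∈ σ.vertexFinset) {h : H}
    (hh : ∀ v ∈ σ.vertexFinset, v ≠ m → orientation h.1 v.pt = 0) :
    SignType.sign (orientation h.1 m.pt) = σ.1 h := by
  rw [← hH.signVector_sum_vertices σ, signVector, map_sum, Finset.sum_eq_single_of_mem m hm hh]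

/-- The cell adjacent to an open cell of a hyperplane through the wall opposite to a vertex. -/
theorem exists_adjacent (hσ : σ.IsGenericIn a) {m : Cell H} (hm : m ∈ σ.vertexFinset) :
    ∃ ρ : Cell H, ρ.IsGenericIn a ∧ (∀ v ∈ σ.vertexFinset, v ≠ m → v ≤ ρ) ∧
      ∀ h : H, ((∀ v ∈ σ.vertexFinset, v ≠ m → orientation h.1 v.pt = 0) → ρ.1 h = -σ.1 h) ∧
        ((∃ v ∈ σ.vertexFinset, v ≠ m ∧ orientation h.1 v.pt ≠ 0) → ρ.1 h = σ.1 h) := by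
  classical
  set q := ∑ v ∈ σ.vertexFinset.erase m, v.pt with hq
  have hzero := Cell.apply_sum_vertices_eq_zero_iff (σ := σ) (Finset.erase_subset m _)
  have hqσ : q ∈ σ.cone := by
    have := Cell.sum_mem_cone (σ := σ) (t := σ.vertexFinset.erase m) (p := Cell.pt)
      (c := fun _ => 1) (fun v hv => Cell.pt_mem_cone.2
        (Cell.mem_vertexFinset.1 (Finset.mem_of_mem_erase hv)).2) (by simp)
    simpa using this
  -- From the point `q` of the wall, step slightly away from `m`: exactly the hyperplanes through
  -- the wall change sign. If `m` is the only vertex, then `q = 0` and the result is the antipodal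
  -- cell.
  obtain ⟨ε, hε, hsign⟩ := exists_pos_sign_add_smul_eq hH.finite q (-m.pt)
  have hpos : ∀ h : H, orientation h.1 q ≠ 0 → signVector H (q + ε • -m.pt) h = σ.1 h :=
    fun h hh => (hsign h hh).trans ((hqσ h).resolve_left fun e => hh (sign_eq_zero_iff.1 e))
  have hneg : ∀ h : H, orientation h.1 q = 0 → signVector H (q + ε • -m.pt) h = -σ.1 h := by
    intro h hh
    rw [← hH.sign_eq_of_wall hm fun v hv hvm => (hzero h).1 hh v (Finset.mem_erase.2 ⟨hvm, hv⟩)]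
    simp [signVector, hh, sign_mul, sign_pos hε, Left.sign_neg]
  have hiff : ∀ h, signVector H (q + ε • -m.pt) h = 0 ↔ σ.1 h = 0 := by
    intro h
    by_cases hh : orientation h.1 q = 0
    · rw [hneg h hh]
      cases σ.1 h <;> decide
    · rw [hpos h hh]
  have hx0 : q + ε • -m.pt ≠ 0 := by
    intro hx0
    obtain ⟨h, hh⟩ := hH.exists_apply_ne_zero σ.pt_ne_zero
    refine hh ((σ.apply_pt_eq_zero_iff h).2 ((hiff h).1 ?_))
    rw [hx0]
    simp [signVector]
  refine ⟨Cell.ofPoint H _ hx0, fun h => (hiff h).trans (hσ h), fun v hv hvm h => ?_, fun h => ?_⟩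
  · by_cases h0 : v.1 h = 0
    · exact Or.inl h0
    · refine Or.inr ?_
      rw [((Cell.mem_vertexFinset.1 hv).2 h).resolve_left h0]
      refine (hpos h fun hh => h0 ?_).symm
      rw [← v.apply_pt_eq_zero_iff]
      exact (hzero h).1 hh v (Finset.mem_erase.2 ⟨hvm, hv⟩)
  · refine ⟨fun hv => hneg h ((hzero h).2 fun v hv' => hv v (Finset.mem_of_mem_erase hv')
      (Finset.ne_of_mem_erase hv')), ?_⟩
    rintro ⟨v, hv, hvm, hne⟩
    exact hpos h fun hh => hne ((hzero h).1 hh v (Finset.mem_erase.2 ⟨hvm, hv⟩))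

end IsSimplicialArrangement

end HypArr

namespace HypArr

/-! ### Facets of the link complex and their ranking. -/

section Facets

variable {V : Type*} [NormedAddCommGroup V] [InnerProductSpace ℝ V] {A H : Set (Submodule ℝ V)}

theorem IsEmbedded.subset_of_isCoatom (hH : IsSimplicialArrangement H) (hA : IsEmbedded A H)
    (hco : ∀ a ∈ A, IsCoatom a) : A ⊆ H := by
  intro a ha
  obtain ⟨S, hS, rfl⟩ := hA.1 ha
  rcases S.eq_empty_or_nonempty with rfl | ⟨h, hh⟩
  · exact absurd sInf_empty (hco _ ha).1
  · rw [← ((hco _ ha).le_iff.1 (sInf_le hh)).resolve_left (hH.hyperplane h (hS hh)).1]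
    exact hS hh

/-- The open cells of the hyperplanes in `A`. -/
def FacetCell (A H : Set (Submodule ℝ V)) : Type _ :=
  {σ : Cell H // ∃ a ∈ A, σ.IsGenericIn a}

/-- The hyperplane containing an open cell. -/
noncomputable def FacetCell.hyp (σ : FacetCell A H) : Submodule ℝ V := σ.2.choose

theorem FacetCell.hyp_mem (σ : FacetCell A H) : σ.hyp ∈ A := σ.2.choose_spec.1

theorem FacetCell.isGenericIn (σ : FacetCell A H) : σ.1.IsGenericIn σ.hyp := σ.2.choose_spec.2

theorem FacetCell.hyp_eq (hAH : A ⊆ H) {σ : FacetCell A H} {a : Submodule ℝ V}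
    (h : σ.1.IsGenericIn a) : σ.hyp = a :=
  (h ⟨_, hAH σ.hyp_mem⟩).1 ((σ.isGenericIn ⟨_, hAH σ.hyp_mem⟩).2 rfl)

open Classical in
/-- The hyperplane of an open cell together with the signs of the cell on all hyperplanes of `A`
that precede it in the numbering `num`. -/
noncomputable def FacetCell.label (num : Submodule ℝ V → ℕ) (σ : FacetCell A H) :
    Submodule ℝ V × (H → SignType) :=
  (σ.hyp, fun h => if h.1 ∈ A ∧ num h.1 < num σ.hyp then σ.1.1 h else 0)

theorem FacetCell.label_eq_iff {num : Submodule ℝ V → ℕ} {σ τ : FacetCell A H} :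
    σ.label num = τ.label num ↔
      σ.hyp = τ.hyp ∧ ∀ h : H, h.1 ∈ A → num h.1 < num σ.hyp → σ.1.1 h = τ.1.1 h := by
  rw [label, label, Prod.mk.injEq]
  refine and_congr_right fun he => ?_
  rw [funext_iff, he]
  refine forall_congr' fun h => ?_
  by_cases hc : h.1 ∈ A ∧ num h.1 < num τ.hyp
  · simp [hc]
  · simp only [hc, if_false, true_iff]
    exact fun h1 h2 => (hc ⟨h1, h2⟩).elim

/-- A chosen open cell with the same label. -/
noncomputable def FacetCell.base (num : Submodule ℝ V → ℕ) (σ : FacetCell A H) : FacetCell A H :=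
  Set.rangeSplitting (FacetCell.label num) ⟨σ.label num, σ, rfl⟩

theorem FacetCell.label_base (num : Submodule ℝ V → ℕ) (σ : FacetCell A H) :
    (σ.base num).label num = σ.label num :=
  Set.apply_rangeSplitting (FacetCell.label num) _

theorem FacetCell.base_eq {num : Submodule ℝ V → ℕ} {σ τ : FacetCell A H}
    (h : σ.label num = τ.label num) : σ.base num = τ.base num := by
  simp only [base, h]

/-- The ranking of open cells: first by hyperplane, then by agreement with the base cell. -/
noncomputable def FacetCell.rank (num : Submodule ℝ V → ℕ) (σ : FacetCell A H) : ℕ ×ₗ ℕ :=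
  toLex (num σ.hyp, {h : H | σ.1.1 h = (σ.base num).1.1 h}.ncard)

theorem FacetCell.rank_le_iff {num : Submodule ℝ V → ℕ} {σ τ : FacetCell A H} :
    σ.rank num ≤ τ.rank num ↔ num σ.hyp < num τ.hyp ∨ num σ.hyp = num τ.hyp ∧
      {h : H | σ.1.1 h = (σ.base num).1.1 h}.ncard ≤ {h : H | τ.1.1 h = (τ.base num).1.1 h}.ncard :=
  Prod.Lex.toLex_le_toLex

theorem FacetCell.rank_lt_iff {num : Submodule ℝ V → ℕ} {σ τ : FacetCell A H} :
    σ.rank num < τ.rank num ↔ num σ.hyp < num τ.hyp ∨ num σ.hyp = num τ.hyp ∧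
      {h : H | σ.1.1 h = (σ.base num).1.1 h}.ncard < {h : H | τ.1.1 h = (τ.base num).1.1 h}.ncard :=
  Prod.Lex.toLex_lt_toLex

end Facets

/-! ### The exchange property and shellability of the link complex. -/

namespace IsSimplicialArrangement

variable {V : Type*} [NormedAddCommGroup V] [InnerProductSpace ℝ V] {A H : Set (Submodule ℝ V)}
  (hH : IsSimplicialArrangement H)

include hH

theorem ne_bot_of_isGenericIn {a : Submodule ℝ V} (haH : a ∈ H) {σ : Cell H}
    (hσ : σ.IsGenericIn a) : a ≠ ⊥ :=
  (Submodule.ne_bot_iff a).2 ⟨σ.pt, hH.pt_mem_of_isGenericIn haH hσ, σ.pt_ne_zero⟩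

theorem finrank_hyperplane [FiniteDimensional ℝ V] {a : Submodule ℝ V} (ha : a ∈ H) :
    Module.finrank ℝ a + 1 = Module.finrank ℝ V := by
  have hk := ker_orientation (hH.hyperplane a ha)
  have hne : orientation a ≠ 0 := by
    rintro h0
    rw [h0, LinearMap.ker_zero] at hk
    exact (hH.hyperplane a ha).1 hk.symm
  have := Module.Dual.finrank_ker_add_one_of_ne_zero hne
  rwa [hk] at this

variable [Finite (Cell H)]

/-- If some vertex outside the common face has a nonnegative coordinate at the base point, crossing
the opposite wall leads to an open cell of smaller rank. -/
theorem exists_rank_lt [FiniteDimensional ℝ V] (hAH : A ⊆ H) (num : Submodule ℝ V → ℕ)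
    (σ : FacetCell A H) {β : Cell H → ℝ}
    (hβ : ∑ v ∈ σ.1.vertexFinset, β v • v.pt = (σ.base num).1.pt) {m : Cell H}
    (hm : m ∈ σ.1.vertexFinset) (hβm : 0 ≤ β m) :
    ∃ ρ : FacetCell A H, ρ.rank num < σ.rank num ∧
      ∀ v ∈ σ.1.vertexFinset, v ≠ m → v ∈ ρ.1.vertexFinset := by
  classical
  have := hH.finite.to_subtype
  have hvert : ∀ {ρ : Cell H} {v}, v ∈ σ.1.vertexFinset → v ≤ ρ → v ∈ ρ.vertexFinset :=
    fun hv hle => Cell.mem_vertexFinset.2 ⟨(Cell.mem_vertexFinset.1 hv).1, hle⟩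
  -- If the wall lies in an earlier hyperplane of `A`, an open cell of that hyperplane contains it.
  -- Otherwise the neighbour across the wall keeps the label, hence the base cell.
  by_cases hwall : ∃ h : H, h.1 ∈ A ∧ num h.1 < num σ.hyp ∧
      ∀ v ∈ σ.1.vertexFinset, v ≠ m → orientation h.1 v.pt = 0
  · obtain ⟨h, hhA, hnum, hv⟩ := hwall
    have hne : h.1 ≠ ⊥ := by
      intro hbot
      have h1 := hH.finrank_hyperplane h.2
      have h2 := hH.finrank_hyperplane (hAH σ.hyp_mem)
      rw [hbot, finrank_bot] at h1
      have h3 : Module.finrank ℝ σ.hyp = 0 := by omega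
      exact hH.ne_bot_of_isGenericIn (hAH σ.hyp_mem) σ.isGenericIn
        (Submodule.finrank_eq_zero.1 h3)
    have hq : ∑ v ∈ σ.1.vertexFinset.erase m, v.pt ∈ h.1 := Submodule.sum_mem _ fun v hv' =>
      (hH.mem_iff h _).2 (hv v (Finset.mem_of_mem_erase hv') (Finset.ne_of_mem_erase hv'))
    obtain ⟨ρ, hρ, hqρ⟩ := hH.exists_isGenericIn h.2 hne hq
    refine ⟨⟨ρ, h.1, hhA, hρ⟩, ?_, fun v hv' hvm => hvert hv' fun k => ?_⟩
    · refine FacetCell.rank_lt_iff.2 (Or.inl ?_)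
      rwa [FacetCell.hyp_eq hAH (σ := ⟨ρ, h.1, hhA, hρ⟩) hρ]
    · by_cases h0 : v.1 k = 0
      · exact Or.inl h0
      · have hqk : orientation k.1 (∑ v ∈ σ.1.vertexFinset.erase m, v.pt) ≠ 0 := fun hq0 => h0 <| by
          rw [← v.apply_pt_eq_zero_iff]
          exact (Cell.apply_sum_vertices_eq_zero_iff (Finset.erase_subset _ _) k).1 hq0 v
            (Finset.mem_erase.2 ⟨hvm, hv'⟩)
        have hqσ : ∑ v ∈ σ.1.vertexFinset.erase m, v.pt ∈ σ.1.cone := by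
          have := Cell.sum_mem_cone (σ := σ.1) (t := σ.1.vertexFinset.erase m) (p := Cell.pt)
            (c := fun _ => 1) (fun v hv => Cell.pt_mem_cone.2
              (Cell.mem_vertexFinset.1 (Finset.mem_of_mem_erase hv)).2) (by simp)
          simpa using this
        have hs : SignType.sign (orientation k.1 (∑ v ∈ σ.1.vertexFinset.erase m, v.pt)) ≠ 0 :=
          fun e => hqk (sign_eq_zero_iff.1 e)
        refine Or.inr ?_
        rw [← (hqρ k).resolve_left hs, ((Cell.mem_vertexFinset.1 hv').2 k).resolve_left h0,
          (hqσ k).resolve_left hs]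
  · push Not at hwall
    obtain ⟨ρ, hρ, hρv, hflip⟩ := hH.exists_adjacent σ.isGenericIn hm
    set ρ' : FacetCell A H := ⟨ρ, σ.hyp, σ.hyp_mem, hρ⟩ with hρ'
    have hhyp : ρ'.hyp = σ.hyp := FacetCell.hyp_eq hAH hρ
    have hlabel : ρ'.label num = σ.label num := by
      refine FacetCell.label_eq_iff.2 ⟨hhyp, fun h hhA hnum => ?_⟩
      rw [hhyp] at hnum
      exact (hflip h).2 (hwall h hhA hnum)
    refine ⟨ρ', ?_, fun v hv hvm => hvert hv (hρv v hv hvm)⟩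
    rw [FacetCell.rank_lt_iff, FacetCell.base_eq hlabel, hhyp]
    refine Or.inr ⟨rfl, Set.ncard_lt_ncard ?_ (Set.toFinite _)⟩
    have hbase : (σ.base num).hyp = σ.hyp :=
      (FacetCell.label_eq_iff.1 (FacetCell.label_base num σ)).1
    -- For a hyperplane through the wall, only `m` contributes to its value at the base point. Since
    -- `0 ≤ β m` and the base cell is generic, `σ` agrees with the base cell there, and crossing the
    -- wall destroys this agreement.
    have hB : ∀ h : H, (∀ v ∈ σ.1.vertexFinset, v ≠ m → orientation h.1 v.pt = 0) →
        h.1 ≠ σ.hyp → σ.1.1 h = (σ.base num).1.1 h := by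
      intro h hv hne
      have hb : (σ.base num).1.1 h ≠ 0 := by
        rw [Ne, (σ.base num).isGenericIn h, hbase]
        exact hne
      rw [← (σ.base num).1.sign_pt h, ← hH.sign_eq_of_wall hm hv] at *
      rw [← hβ, map_sum, Finset.sum_eq_single_of_mem m hm (fun v hv' hvm => by
        rw [map_smul, hv v hv' hvm, smul_zero])] at hb ⊢
      rw [map_smul, smul_eq_mul, sign_mul] at hb ⊢
      have hβ0 : β m ≠ 0 := by
        rintro h0
        simp [h0] at hb
      rw [sign_pos (lt_of_le_of_ne hβm hβ0.symm), one_mul]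
    obtain ⟨h, hv, hm0⟩ := hH.exists_wall hm
    have hσh : σ.1.1 h ≠ 0 := by
      rw [← hH.sign_eq_of_wall hm hv]
      exact fun e => hm0 (sign_eq_zero_iff.1 e)
    have hha : h.1 ≠ σ.hyp := fun e => hσh ((σ.isGenericIn h).2 e)
    have hself : ∀ {s : SignType}, s ≠ 0 → -s ≠ s := by decide
    -- No agreement is gained by crossing, and at least the one at `h` is lost.
    refine (Set.ssubset_iff_of_subset fun k hk => ?_).2 ⟨h, hB h hv hha, fun hk => ?_⟩
    · change σ.1.1 k = _
      by_cases hkv : ∀ v ∈ σ.1.vertexFinset, v ≠ m → orientation k.1 v.pt = 0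
      · by_cases hka : k.1 = σ.hyp
        · rw [(σ.isGenericIn k).2 hka, ((σ.base num).isGenericIn k).2 (hka.trans hbase.symm)]
        · exact hB k hkv hka
      · push Not at hkv
        exact ((hflip k).2 hkv).symm.trans hk
    · exact hself hσh (((hflip h).1 hv).symm.trans (Eq.trans hk (hB h hv hha).symm))

/-- The open cells of the hyperplanes in `A`, ranked by hyperplane and by agreement with a base
cell, form a shelling family. -/
theorem isShellingFamily [FiniteDimensional ℝ V] (hAH : A ⊆ H) {num : Submodule ℝ V → ℕ}
    (hnum : Set.InjOn num A) :
    IsShellingFamily (fun σ : FacetCell A H => σ.1.vertexFinset) (Module.finrank ℝ V - 1)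
      (FacetCell.rank num) where
  finite := inferInstanceAs (Finite {σ : Cell H // _})
  injective σ τ h := Subtype.ext <| hH.eq_of_vertices_eq <| Set.ext fun v => by
    rw [← Cell.mem_vertexFinset, ← Cell.mem_vertexFinset]
    exact Finset.ext_iff.1 h v
  nonempty σ := (hH.vertices_nonempty σ.1).imp fun v hv => Cell.mem_vertexFinset.2 hv
  card_eq σ := by
    rw [hH.card_vertexFinset_of_isGenericIn (hAH σ.hyp_mem) σ.isGenericIn,
      ← hH.finrank_hyperplane (hAH σ.hyp_mem), Nat.add_sub_cancel]
  exchange σ τ hστ hle s hsσ hsτ := by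
    have := hH.finite.to_subtype
    by_contra hcon
    obtain ⟨hbase, hlab⟩ := FacetCell.label_eq_iff.1 (FacetCell.label_base num σ)
    obtain ⟨β, hβ⟩ := hH.exists_sum_eq_of_isGenericIn (hAH σ.hyp_mem) σ.isGenericIn
      (b := (σ.base num).1.pt)
      (hbase ▸ hH.pt_mem_of_isGenericIn (hAH (σ.base num).hyp_mem) (σ.base num).isGenericIn)
    have hneg : ∀ m ∈ σ.1.vertexFinset, m ∉ s → β m ≤ 0 := by
      intro m hm hms
      by_contra! hpos
      obtain ⟨ρ, hρ, hv⟩ := hH.exists_rank_lt hAH num σ hβ hm hpos.le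
      exact hcon ⟨m, hm, hms, ρ, hρ, hv⟩
    -- Only vertices outside `s` contribute to the value of `h` at the base point, all with
    -- nonpositive coordinates. Since the base point is off `h`, its sign is opposite to that of
    -- `σ`.
    have hsep : ∀ h : H, (∀ v ∈ s, v.1 h = 0) → h.1 ≠ σ.hyp →
        σ.1.1 h ≠ (σ.base num).1.1 h := by
      intro h hs hne heq
      have hle : (σ.1.1 h : ℝ) * orientation h.1 (σ.base num).1.pt ≤ 0 := by
        rw [← hβ, map_sum, Finset.mul_sum]
        refine Finset.sum_nonpos fun v hv => ?_
        rw [map_smul, smul_eq_mul, mul_left_comm]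
        by_cases hvs : v ∈ s
        · rw [(v.apply_pt_eq_zero_iff h).2 (hs v hvs), mul_zero, mul_zero]
        · exact mul_nonpos_of_nonpos_of_nonneg (hneg v hv hvs) (Cell.mem_cone_iff.1
            (Cell.pt_mem_cone.2 (Cell.mem_vertexFinset.1 hv).2) h).1
      have hb : orientation h.1 (σ.base num).1.pt ≠ 0 := by
        rw [Ne, Cell.apply_pt_eq_zero_iff, ← heq, σ.isGenericIn h]
        exact hne
      rw [heq, ← Cell.sign_pt, sign_mul_self] at hle
      exact hb (abs_nonpos_iff.1 hle)
    -- A vertex off `h` forces its own sign on every cell containing it.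
    have hshared : ∀ h : H, τ.1.1 h ≠ σ.1.1 h → ∀ v ∈ s, v.1 h = 0 := by
      intro h hne v hv
      by_contra h0
      exact hne ((((Cell.mem_vertexFinset.1 (hsτ hv)).2 h).resolve_left h0).symm.trans
        (((Cell.mem_vertexFinset.1 (hsσ hv)).2 h).resolve_left h0))
    -- An earlier hyperplane `τ.hyp` would contain `s` and so separate `σ` from its base cell,
    -- against the equality of their labels.
    rcases FacetCell.rank_le_iff.1 hle with hlt | ⟨heq, hcard⟩
    · have hne : τ.hyp ≠ σ.hyp := fun e => hlt.ne (congrArg num e)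
      have hτ0 := (τ.isGenericIn ⟨τ.hyp, hAH τ.hyp_mem⟩).2 rfl
      refine hsep ⟨τ.hyp, hAH τ.hyp_mem⟩ (hshared _ fun e => hne ?_) hne
        (hlab _ τ.hyp_mem (hbase ▸ hlt)).symm
      exact (σ.isGenericIn ⟨τ.hyp, hAH τ.hyp_mem⟩).1 (e.symm.trans hτ0)
    · have hhyp : τ.hyp = σ.hyp := hnum τ.hyp_mem σ.hyp_mem heq
      have hlabel : τ.label num = σ.label num := by
        refine FacetCell.label_eq_iff.2 ⟨hhyp, fun h hhA hlt => ?_⟩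
        by_contra hne
        rw [hhyp] at hlt
        exact hsep h (hshared h hne) (fun e => hlt.ne (congrArg num e))
          (hlab h hhA (hbase ▸ hlt)).symm
      rw [FacetCell.base_eq hlabel] at hcard
      refine absurd hcard (not_le.2 (Set.ncard_lt_ncard ?_ (Set.toFinite _)))
      obtain ⟨h, hh⟩ : ∃ h, τ.1.1 h ≠ σ.1.1 h := by
        by_contra! hall
        exact hστ (Subtype.ext (Subtype.ext (funext hall))).symm
      have hha : h.1 ≠ σ.hyp := fun e => hh <| by
        rw [(σ.isGenericIn h).2 e, (τ.isGenericIn h).2 (e.trans hhyp.symm)]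
      -- With only two nonzero signs, where `σ` differs from both `τ` and the base cell, those two
      -- agree.
      have hsign : ∀ {s t u : SignType}, s ≠ 0 → t ≠ 0 → u ≠ 0 → t ≠ s → s ≠ u → t = u := by
        decide
      refine (Set.ssubset_iff_of_subset fun k hk => ?_).2 ⟨h, hsign (s := σ.1.1 h) ?_ ?_ ?_ hh
        (hsep h (hshared h hh) hha), hsep h (hshared h hh) hha⟩
      · change τ.1.1 k = _
        by_contra hne
        have hk' : τ.1.1 k ≠ σ.1.1 k := fun e => hne (e.trans hk)
        by_cases hka : k.1 = σ.hyp
        · exact hk' (by rw [(σ.isGenericIn k).2 hka, (τ.isGenericIn k).2 (hka.trans hhyp.symm)])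
        · exact hsep k (hshared k hk') hka hk
      · rwa [Ne, σ.isGenericIn h]
      · rwa [Ne, τ.isGenericIn h, hhyp]
      · rwa [Ne, (σ.base num).isGenericIn h, hbase]

omit [Finite (Cell H)] in
theorem exists_facetCell_of_carrier_subset (hAH : A ⊆ H) {σ : Cell H}
    (hσ : σ.carrier ⊆ ⋃ a ∈ A, (a : Set V)) : ∃ ρ : FacetCell A H, σ ≤ ρ.1 := by
  obtain ⟨p, hp, hpσ⟩ := σ.2
  obtain ⟨a, ha, hpa⟩ := Set.mem_iUnion₂.1 (hσ ⟨hp, hpσ⟩)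
  have hne : a ≠ ⊥ := (Submodule.ne_bot_iff a).2 ⟨p, hpa, fun h0 => by simp [h0] at hp⟩
  obtain ⟨ρ, hρ, hpρ⟩ := hH.exists_isGenericIn (hAH ha) hne hpa
  refine ⟨⟨ρ, a, ha, hρ⟩, fun h => ?_⟩
  rw [← hpσ]
  exact hpρ h

omit [Finite (Cell H)] in
theorem carrier_subset (hAH : A ⊆ H) (σ : FacetCell A H) :
    σ.1.carrier ⊆ ⋃ a ∈ A, (a : Set V) := by
  rintro p ⟨-, hp⟩
  refine Set.mem_iUnion₂.2 ⟨σ.hyp, σ.hyp_mem, (hH.mem_iff ⟨σ.hyp, hAH σ.hyp_mem⟩ p).2 ?_⟩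
  rw [← sign_eq_zero_iff, ← (σ.isGenericIn ⟨σ.hyp, hAH σ.hyp_mem⟩).2 rfl, ← hp]
  rfl

omit [Finite (Cell H)] in
theorem exists_injOn_num (hAH : A ⊆ H) : ∃ num : Submodule ℝ V → ℕ, Set.InjOn num A :=
  Set.countable_iff_exists_injOn.1 (hH.finite.subset hAH).countable

omit [Finite (Cell H)] in
theorem shellable_linkComplex [FiniteDimensional ℝ V] (hA : IsEmbedded A H)
    (hco : ∀ a ∈ A, IsCoatom a) : Shellable (linkComplex A H) := by
  have hAH := hA.subset_of_isCoatom hH hco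
  have := finite_cell hH.finite
  obtain ⟨num, hnum⟩ := hH.exists_injOn_num hAH
  refine (hH.isShellingFamily hAH hnum).shellable fun s => and_congr_right fun _ => ⟨?_, ?_⟩
  · rintro ⟨σ, hσ, hs⟩
    obtain ⟨ρ, hρ⟩ := hH.exists_facetCell_of_carrier_subset hAH hσ
    exact ⟨ρ, fun v hv => Cell.mem_vertexFinset.2 (Cell.vertices_mono hρ (hs hv))⟩
  · rintro ⟨ρ, hs⟩
    exact ⟨ρ.1, hH.carrier_subset hAH ρ, fun v hv => Cell.mem_vertexFinset.1 (hs hv)⟩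

end IsSimplicialArrangement

end HypArr

namespace HypArr

/-! ### A combinatorial criterion for simpliciality. -/

section Criterion

variable {V : Type*} [NormedAddCommGroup V] [InnerProductSpace ℝ V] {H : Set (Submodule ℝ V)}
  {γ : Type*} {c : Cell H → Set γ}

/-- Sufficient data for the cells to form a simplicial complex: an order embedding of the cells into
sets whose image consists of nonempty sets and is closed under taking nonempty subsets. -/
structure IsSimplexLabeling (c : Cell H → Set γ) : Prop where
  le_iff : ∀ σ τ, σ ≤ τ ↔ c σ ⊆ c τ
  nonempty : ∀ σ, (c σ).Nonempty
  exists_eq : ∀ σ t, t ⊆ c σ → t.Nonempty → ∃ τ, c τ = t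

namespace IsSimplexLabeling

variable (hc : IsSimplexLabeling c)

include hc

theorem eq_of_eq {σ τ : Cell H} (h : c σ = c τ) : σ = τ :=
  le_antisymm ((hc.le_iff _ _).2 h.le) ((hc.le_iff _ _).2 h.ge)

theorem exists_eq_singleton {σ : Cell H} {S : γ} (hS : S ∈ c σ) :
    ∃ v ∈ σ.vertices, c v = {S} := by
  obtain ⟨v, hv⟩ := hc.exists_eq σ {S} (Set.singleton_subset_iff.2 hS) (Set.singleton_nonempty S)
  refine ⟨v, ⟨fun τ hτ => ?_, ?_⟩, hv⟩
  · rw [hc.le_iff, hv] at hτ ⊢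
    exact ((hc.nonempty τ).subset_singleton_iff.1 hτ).ge
  · rw [hc.le_iff, hv]
    exact Set.singleton_subset_iff.2 hS

theorem eq_singleton_of_mem {v : Cell H} (hv : IsMin v) {S : γ} (hS : S ∈ c v) : c v = {S} := by
  obtain ⟨w, hw, hwS⟩ := hc.exists_eq_singleton hS
  rw [← hwS, hv.eq_of_le hw.2]

/-- Singleton labels are exactly the labels of minimal cells, so the vertices of `σ` correspond to
the elements of `c σ`. -/
theorem vertices_eq (σ : Cell H) : σ.vertices = {v | ∃ S ∈ c σ, c v = {S}} := by
  ext v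
  constructor
  · rintro ⟨hmin, hle⟩
    obtain ⟨S, hS⟩ := hc.nonempty v
    exact ⟨S, (hc.le_iff _ _).1 hle hS, hc.eq_singleton_of_mem hmin hS⟩
  · rintro ⟨S, hS, hv⟩
    obtain ⟨w, hw, hwS⟩ := hc.exists_eq_singleton hS
    rwa [hc.eq_of_eq (hv.trans hwS.symm)]

theorem isSimplicialArrangement (hfin : H.Finite) (hhyp : ∀ h ∈ H, IsCoatom h)
    (hess : sInf H = ⊥) : IsSimplicialArrangement H where
  finite := hfin
  hyperplane := hhyp
  essential := hess
  le_of_vertices_subset σ τ h := (hc.le_iff _ _).2 fun S hS => by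
    obtain ⟨v, hv, hvS⟩ := hc.exists_eq_singleton hS
    exact (hc.le_iff _ _).1 (h hv).2 (hvS ▸ Set.mem_singleton S)
  vertices_nonempty σ := by
    obtain ⟨S, hS⟩ := hc.nonempty σ
    obtain ⟨v, hv, -⟩ := hc.exists_eq_singleton hS
    exact ⟨v, hv⟩
  exists_vertices_eq σ t ht htne := by
    rw [hc.vertices_eq] at ht
    have hsub : {S | ∃ v ∈ t, c v = {S}} ⊆ c σ := by
      rintro S ⟨v, hv, hvS⟩
      obtain ⟨T, hT, hvT⟩ := ht hv
      rwa [Set.singleton_injective (hvS.symm.trans hvT)]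
    obtain ⟨v, hv⟩ := htne
    obtain ⟨S, -, hvS⟩ := ht hv
    obtain ⟨τ, hτ⟩ := hc.exists_eq σ _ hsub ⟨S, v, hv, hvS⟩
    refine ⟨τ, ?_⟩
    rw [hc.vertices_eq, hτ]
    ext w
    constructor
    · rintro ⟨T, ⟨u, hu, huT⟩, hwT⟩
      rwa [hc.eq_of_eq (hwT.trans huT.symm)]
    · intro hw
      obtain ⟨T, -, hwT⟩ := ht hw
      exact ⟨T, ⟨w, hw, hwT⟩, hwT⟩

end IsSimplexLabeling

end Criterion

/-! ### The braid arrangement, graphical arrangements and coloring complexes. -/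

section Braid

variable {n : ℕ}

theorem isCoatom_eqHyperplane {i j : Fin n} (hij : i ≠ j) : IsCoatom (eqHyperplane i j) := by
  let f : zeroSum n →ₗ[ℝ] ℝ :=
    { toFun := fun x => x.1 i - x.1 j
      map_add' := fun x y => by simp; ring
      map_smul' := fun c x => by simp; ring }
  have hk : LinearMap.ker f = eqHyperplane i j := by
    ext x
    exact sub_eq_zero
  rw [← hk]
  refine LinearMap.isCoatom_ker_of_surjective (LinearMap.surjective ?_)
  let e : zeroSum n := ⟨EuclideanSpace.single i 1 - EuclideanSpace.single j 1, by
    change ∑ k, _ = (0 : ℝ)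
    simp⟩
  intro h0
  have h1 : f e = 0 := by rw [h0, LinearMap.zero_apply]
  have h2 : f e = 2 := by
    simp [f, e, hij, hij.symm]
    norm_num
  rw [h1] at h2
  norm_num at h2

theorem eqHyperplane_comm (i j : Fin n) : eqHyperplane i j = eqHyperplane j i := by
  ext x
  exact eq_comm

theorem eqHyperplane_mem_braidArrangement {i j : Fin n} (hij : i ≠ j) :
    eqHyperplane i j ∈ braidArrangement n := by
  rcases lt_or_gt_of_ne hij with h | h
  · exact ⟨i, j, h, rfl⟩
  · exact ⟨j, i, h, eqHyperplane_comm i j⟩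

theorem isCoatom_of_mem_braidArrangement {h : Submodule ℝ (zeroSum n)}
    (hh : h ∈ braidArrangement n) : IsCoatom h := by
  obtain ⟨i, j, hij, rfl⟩ := hh
  exact isCoatom_eqHyperplane hij.ne

theorem finite_braidArrangement (n : ℕ) : (braidArrangement n).Finite :=
  (Set.finite_range fun p : Fin n × Fin n => eqHyperplane p.1 p.2).subset
    fun _ ⟨i, j, _, h⟩ => ⟨(i, j), h.symm⟩

theorem eq_zero_of_forall_eq {x : zeroSum n} (h : ∀ i j, x.1 i = x.1 j) : x = 0 := by
  refine Subtype.ext (PiLp.ext fun i => ?_)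
  have hs : ∑ k, x.1 k = 0 := x.2
  rw [Finset.sum_congr rfl fun k _ => h k i] at hs
  simpa [(Fin.pos i).ne'] using hs

theorem sInf_braidArrangement (n : ℕ) : sInf (braidArrangement n) = ⊥ := by
  refine (Submodule.eq_bot_iff _).2 fun x hx => eq_zero_of_forall_eq fun i j => ?_
  by_cases hij : i = j
  · rw [hij]
  · exact (Submodule.mem_sInf.1 hx) _ (eqHyperplane_mem_braidArrangement hij)

/-- An orientation of `xᵢ = xⱼ` is a nonzero multiple of `xᵢ - xⱼ`. -/
theorem exists_orientation_eqHyperplane {i j : Fin n} (hij : i ≠ j) :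
    ∃ c : ℝ, c ≠ 0 ∧ ∀ x : zeroSum n, orientation (eqHyperplane i j) x = c * (x.1 i - x.1 j) := by
  have hco := isCoatom_eqHyperplane hij
  have hk := ker_orientation hco
  obtain ⟨y, -, hy⟩ := SetLike.exists_of_lt hco.1.lt_top
  have hy' : y.1 i - y.1 j ≠ 0 := fun h => hy (sub_eq_zero.1 h)
  have hoy : orientation (eqHyperplane i j) y ≠ 0 := fun h => hy (hk ▸ h)
  refine ⟨orientation (eqHyperplane i j) y / (y.1 i - y.1 j), div_ne_zero hoy hy', fun x => ?_⟩
  have hmem : (y.1 i - y.1 j) • x - (x.1 i - x.1 j) • y ∈ eqHyperplane i j := by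
    change _ = _
    simp
    ring
  rw [← hk, LinearMap.mem_ker, map_sub, map_smul, map_smul, smul_eq_mul, smul_eq_mul,
    sub_eq_zero] at hmem
  field_simp
  linarith

/-- The proper nonempty subsets of `[n]` on which all coordinates of `x` are larger than those
outside. -/
def upperSets (x : zeroSum n) : Set (Finset (Fin n)) :=
  {S | (S.Nonempty ∧ S ≠ Finset.univ) ∧ ∀ i ∈ S, ∀ j ∉ S, x.1 j < x.1 i}

theorem upperSet_mem {x : zeroSum n} {i j : Fin n} (hij : x.1 i < x.1 j) :
    (Finset.univ.filter fun k => x.1 j ≤ x.1 k) ∈ upperSets x := by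
  refine ⟨⟨⟨j, by simp⟩, fun h => ?_⟩, fun k hk l hl => ?_⟩
  · have := h ▸ Finset.mem_univ i
    simp only [Finset.mem_filter, Finset.mem_univ, true_and] at this
    exact this.not_gt hij
  · simp only [Finset.mem_filter, Finset.mem_univ, true_and, not_le] at hk hl
    exact hl.trans_le hk

theorem upperSets_subset_iff {x y : zeroSum n} :
    upperSets x ⊆ upperSets y ↔ ∀ i j, x.1 i < x.1 j → y.1 i < y.1 j := by
  constructor
  · intro h i j hij
    refine (h (upperSet_mem hij)).2 j (by simp) i ?_
    simpa using hij
  · exact fun h S hS => ⟨hS.1, fun i hi j hj => h _ _ (hS.2 i hi j hj)⟩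

/-- The unknown nonzero factor in each chosen orientation multiplies both signs and cancels, so the
face order depends only on the order of the coordinates. -/
theorem signVector_le_iff {x y : zeroSum n} :
    (∀ h, signVector (braidArrangement n) x h = 0 ∨
      signVector (braidArrangement n) x h = signVector (braidArrangement n) y h) ↔
      ∀ i j, x.1 i < x.1 j → y.1 i < y.1 j := by
  have key : ∀ i j : Fin n, i < j → ∀ hm : eqHyperplane i j ∈ braidArrangement n,
      (signVector (braidArrangement n) x ⟨_, hm⟩ = 0 ∨ signVector (braidArrangement n) x ⟨_, hm⟩ =
        signVector (braidArrangement n) y ⟨_, hm⟩) ↔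
      (x.1 i < x.1 j → y.1 i < y.1 j) ∧ (x.1 j < x.1 i → y.1 j < y.1 i) := by
    intro i j hij hm
    obtain ⟨c, hc, hor⟩ := exists_orientation_eqHyperplane hij.ne
    have hc' : SignType.sign c ≠ 0 := fun h => hc (sign_eq_zero_iff.1 h)
    simp only [signVector, hor, sign_mul, mul_eq_zero, hc', false_or]
    rw [mul_right_inj' hc']
    rcases lt_trichotomy (x.1 i - x.1 j) 0 with h | h | h
    · have h1 : x.1 i < x.1 j := by linarith
      rw [sign_neg h, eq_comm (a := (-1 : SignType)) (b := SignType.sign _), sign_eq_neg_one_iff]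
      simp [h1, h1.not_gt]
    · have h1 : x.1 i = x.1 j := by linarith
      simp [h1]
    · have h1 : x.1 j < x.1 i := by linarith
      rw [sign_pos h, eq_comm (a := (1 : SignType)) (b := SignType.sign _), sign_eq_one_iff]
      simp [h1, h1.not_gt]
  constructor
  · intro h i j hx
    rcases lt_trichotomy i j with hij | hij | hij
    · exact ((key i j hij ⟨i, j, hij, rfl⟩).1 (h _)).1 hx
    · exact absurd hx (by rw [hij]; exact lt_irrefl _)
    · exact ((key j i hij ⟨j, i, hij, rfl⟩).1 (h _)).2 hx
  · rintro h ⟨_, i, j, hij, rfl⟩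
    exact (key i j hij _).2 ⟨h i j, h j i⟩

theorem upperSets_nonempty {x : zeroSum n} (hx : x ≠ 0) : (upperSets x).Nonempty := by
  obtain ⟨i, j, hij⟩ : ∃ i j, x.1 i ≠ x.1 j := by
    by_contra! h
    exact hx (eq_zero_of_forall_eq h)
  rcases lt_or_gt_of_ne hij with h | h
  · exact ⟨_, upperSet_mem h⟩
  · exact ⟨_, upperSet_mem h⟩

theorem isChain_upperSets (x : zeroSum n) : IsChain (· ⊆ ·) (upperSets x) := by
  intro S hS T hT _
  by_contra! h
  obtain ⟨⟨i, hiS, hiT⟩, j, hjT, hjS⟩ := And.imp Finset.not_subset.1 Finset.not_subset.1 h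
  exact (hS.2 i hiS j hjS).asymm (hT.2 j hjT i hiT)

open Classical in
/-- The centered sum of the indicator vectors of a family of sets. -/
noncomputable def chainVector (t : Finset (Finset (Fin n))) : zeroSum n :=
  ⟨WithLp.toLp 2 fun i => ((t.filter (i ∈ ·)).card : ℝ) - (∑ j, ((t.filter (j ∈ ·)).card : ℝ)) / n, by
    change ∑ i, _ = (0 : ℝ)
    rcases Nat.eq_zero_or_pos n with rfl | hn
    · simp
    · simp
      field_simp
      simp⟩

open Classical in
theorem chainVector_lt_iff {t : Finset (Finset (Fin n))} {i j : Fin n} :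
    (chainVector t).1 i < (chainVector t).1 j ↔ (t.filter (i ∈ ·)).card < (t.filter (j ∈ ·)).card := by
  simp [chainVector]

open Classical in
theorem chainVector_eq_iff {t : Finset (Finset (Fin n))} {i j : Fin n} :
    (chainVector t).1 i = (chainVector t).1 j ↔ (t.filter (i ∈ ·)).card = (t.filter (j ∈ ·)).card := by
  simp [chainVector]

/-- In a chain, the number of members containing `i` determines which members contain `i`. Up to a
common shift these numbers are the coordinates of `chainVector t`, so the chain is recovered from
them. -/
theorem upperSets_chainVector {t : Finset (Finset (Fin n))}
    (hchain : IsChain (· ⊆ ·) (t : Set (Finset (Fin n))))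
    (ht : ∀ S ∈ t, S.Nonempty ∧ S ≠ Finset.univ) : upperSets (chainVector t) = t := by
  classical
  have hcomp : ∀ i j, (∀ S ∈ t, i ∈ S → j ∈ S) ∨ (∀ S ∈ t, j ∈ S → i ∈ S) := by
    intro i j
    by_contra! h
    obtain ⟨⟨S, hS, hiS, hjS⟩, T, hT, hjT, hiT⟩ := h
    rcases hchain.total hS hT with hST | hTS
    · exact hiT (hST hiS)
    · exact hjS (hTS hjT)
  have hle : ∀ i j, (t.filter (i ∈ ·)).card ≤ (t.filter (j ∈ ·)).card → ∀ S ∈ t, i ∈ S → j ∈ S := by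
    intro i j hij S hS hi
    rcases hcomp i j with h | h
    · exact h S hS hi
    · have heq : t.filter (j ∈ ·) = t.filter (i ∈ ·) := Finset.eq_of_subset_of_card_le
        (fun T hT => by
          rw [Finset.mem_filter] at hT ⊢
          exact ⟨hT.1, h T hT.1 hT.2⟩) hij
      have : S ∈ t.filter (j ∈ ·) := heq ▸ Finset.mem_filter.2 ⟨hS, hi⟩
      exact (Finset.mem_filter.1 this).2
  ext S
  constructor
  · rintro ⟨⟨hne, huniv⟩, hS⟩
    simp only [chainVector_lt_iff] at hS
    obtain ⟨i, hi, himin⟩ := Finset.exists_min_image S (fun k => (t.filter (k ∈ ·)).card) hne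
    obtain ⟨j, hj, hjmax⟩ := Finset.exists_max_image Sᶜ (fun k => (t.filter (k ∈ ·)).card)
      (by rwa [Finset.nonempty_iff_ne_empty, Ne, Finset.compl_eq_empty_iff])
    rw [Finset.mem_compl] at hj
    -- A member of `t` separating the lowest element of `S` from the highest element outside it must
    -- be `S` itself.
    obtain ⟨T, hT, hiT, hjT⟩ : ∃ T ∈ t, i ∈ T ∧ j ∉ T := by
      by_contra! hcon
      refine (hS i hi j hj).not_ge (Finset.card_le_card fun T hT => ?_)
      rw [Finset.mem_filter] at hT ⊢
      exact ⟨hT.1, hcon T hT.1 hT.2⟩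
    have : S = T := by
      ext k
      refine ⟨fun hk => hle i k (himin k hk) T hT hiT, fun hk => ?_⟩
      by_contra hkS
      exact hjT (hle k j (hjmax k (Finset.mem_compl.2 hkS)) T hT hk)
    rwa [this]
  · intro hS
    refine ⟨ht S hS, fun i hi j hj => chainVector_lt_iff.2 ?_⟩
    by_contra! h
    exact hj (hle i j h S hS hi)

theorem chainVector_ne_zero {t : Finset (Finset (Fin n))}
    (hchain : IsChain (· ⊆ ·) (t : Set (Finset (Fin n))))
    (ht : ∀ S ∈ t, S.Nonempty ∧ S ≠ Finset.univ) (hne : t.Nonempty) : chainVector t ≠ 0 := by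
  intro h0
  obtain ⟨S, hS⟩ := hne
  have hSu : S ∈ upperSets (chainVector t) := by
    rw [upperSets_chainVector hchain ht]
    exact hS
  obtain ⟨⟨⟨i, hi⟩, huniv⟩, hlt⟩ := hSu
  obtain ⟨j, hj⟩ : ∃ j, j ∉ S := by
    by_contra! h
    exact huniv (Finset.eq_univ_of_forall h)
  have := hlt i hi j hj
  simp [h0] at this

/-- The chain of subsets of `[n]` corresponding to a cell of the braid arrangement. -/
def braidChain (σ : Cell (braidArrangement n)) : Set (Finset (Fin n)) := upperSets σ.pt

theorem braidChain_ofPoint {x : zeroSum n} (hx : x ≠ 0) :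
    braidChain (Cell.ofPoint (braidArrangement n) x hx) = upperSets x := by
  have h : signVector (braidArrangement n) (Cell.ofPoint (braidArrangement n) x hx).pt
      = signVector (braidArrangement n) x := Cell.signVector_pt _
  refine Set.Subset.antisymm ?_ ?_ <;> rw [braidChain, upperSets_subset_iff, ← signVector_le_iff]
    <;> exact fun k => Or.inr (by rw [h])

theorem isSimplexLabeling_braidChain (n : ℕ) : IsSimplexLabeling (braidChain (n := n)) where
  le_iff σ τ := by
    rw [← Cell.pt_mem_cone, braidChain, braidChain, upperSets_subset_iff, ← signVector_le_iff,
      τ.signVector_pt]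
    rfl
  nonempty σ := upperSets_nonempty σ.pt_ne_zero
  exists_eq σ t ht hne := by
    classical
    obtain ⟨t, rfl⟩ := t.toFinite.exists_finset_coe
    have hchain := (isChain_upperSets σ.pt).mono ht
    have hprop : ∀ S ∈ t, S.Nonempty ∧ S ≠ Finset.univ := fun S hS => (ht hS).1
    exact ⟨Cell.ofPoint _ _ (chainVector_ne_zero hchain hprop (by simpa using hne)),
      (braidChain_ofPoint _).trans (upperSets_chainVector hchain hprop)⟩

theorem isSimplicialArrangement_braidArrangement (n : ℕ) :
    IsSimplicialArrangement (braidArrangement n) :=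
  (isSimplexLabeling_braidChain n).isSimplicialArrangement (finite_braidArrangement n)
    (fun _ => isCoatom_of_mem_braidArrangement) (sInf_braidArrangement n)

variable (G : SimpleGraph (Fin n))

theorem graphicalArrangement_subset : graphicalArrangement G ⊆ braidArrangement n := by
  rintro _ ⟨i, j, hij, rfl⟩
  exact eqHyperplane_mem_braidArrangement hij.ne

theorem isCoatom_of_mem_graphicalArrangement {a : Submodule ℝ (zeroSum n)}
    (ha : a ∈ graphicalArrangement G) : IsCoatom a :=
  isCoatom_of_mem_braidArrangement (graphicalArrangement_subset G ha)

theorem isEmbedded_graphicalArrangement :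
    IsEmbedded (graphicalArrangement G) (braidArrangement n) := by
  refine ⟨fun a ha => ⟨{a}, by simpa using graphicalArrangement_subset G ha, by simp⟩, ?_⟩
  intro a ha b hb hab hle
  exact ((isCoatom_of_mem_graphicalArrangement G ha).le_iff.1 hle).elim
    (fun h => (isCoatom_of_mem_graphicalArrangement G hb).1 h) fun h => hab h.symm

theorem shellable_linkComplex_graphicalArrangement :
    Shellable (linkComplex (graphicalArrangement G) (braidArrangement n)) :=
  (isSimplicialArrangement_braidArrangement n).shellable_linkComplex
    (isEmbedded_graphicalArrangement G) fun _ => isCoatom_of_mem_graphicalArrangement G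

/-- A vertex of the braid decomposition has a one-element chain. Sending it to that element turns
the facets of the link complex into chains, and an edge whose ends no set separates corresponds to a
hyperplane `xᵢ = xⱼ` containing the cell. -/
theorem shellable_coloringComplex : Shellable (coloringComplex G) := by
  classical
  have hH := isSimplicialArrangement_braidArrangement n
  have hAH := graphicalArrangement_subset G
  have hc := isSimplexLabeling_braidChain n
  have := finite_cell hH.finite
  obtain ⟨num, hnum⟩ := hH.exists_injOn_num hAH
  have hmin : ∀ {v : Cell (braidArrangement n)}, IsMin v →
      braidChain v = {(hc.nonempty v).some} :=
    fun hv => hc.eq_singleton_of_mem hv (hc.nonempty _).some_mem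
  have hinj : Set.InjOn (fun v => (hc.nonempty v).some) {v | IsMin v} := by
    intro v hv w hw hvw
    refine hc.eq_of_eq ?_
    rw [hmin hv, hmin hw]
    exact congrArg _ hvw
  have hfam := (hH.isShellingFamily hAH hnum).of_image
    (F' := fun σ => (Set.toFinite (braidChain σ.1)).toFinset) hinj
    (fun σ v hv => (Cell.mem_vertexFinset.1 hv).1) (fun σ S => by
      rw [Set.Finite.mem_toFinset]
      constructor
      · intro hS
        obtain ⟨v, hv, hvS⟩ := hc.exists_eq_singleton hS
        refine ⟨v, Cell.mem_vertexFinset.2 hv, ?_⟩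
        exact Set.singleton_injective ((hmin hv.1).symm.trans hvS)
      · rintro ⟨v, hv, rfl⟩
        exact (hc.le_iff _ _).1 (Cell.mem_vertexFinset.1 hv).2 (hc.nonempty v).some_mem)
  refine hfam.shellable fun t => and_congr_right fun hne => ⟨?_, ?_⟩
  · rintro ⟨hprop, hchain, i, j, hij, hsep⟩
    set σ := Cell.ofPoint (braidArrangement n) _ (chainVector_ne_zero hchain hprop hne) with hσ
    have hchainσ : braidChain σ = t :=
      (braidChain_ofPoint _).trans (upperSets_chainVector hchain hprop)
    -- The ends of the edge lie in the same members of `t`, so their coordinates coincide.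
    have hmem : chainVector t ∈ eqHyperplane i j := by
      refine chainVector_eq_iff.2 (congrArg Finset.card (Finset.filter_congr fun S hS => ?_))
      exact hsep S hS
    have hcar : σ.carrier ⊆ ⋃ a ∈ graphicalArrangement G, (a : Set (zeroSum n)) := by
      rintro p ⟨-, hp⟩
      refine Set.mem_iUnion₂.2 ⟨eqHyperplane i j, ⟨i, j, hij, rfl⟩, ?_⟩
      have hm := eqHyperplane_mem_braidArrangement hij.ne
      refine (hH.mem_iff ⟨_, hm⟩ p).2 (sign_eq_zero_iff.1 ?_)
      refine (congrFun hp ⟨_, hm⟩).trans (sign_eq_zero_iff.2 ?_)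
      exact (hH.mem_iff ⟨_, hm⟩ _).1 hmem
    obtain ⟨ρ, hρ⟩ := hH.exists_facetCell_of_carrier_subset hAH hcar
    refine ⟨ρ, fun S hS => (Set.Finite.mem_toFinset _).2 ((hc.le_iff _ _).1 hρ ?_)⟩
    rw [hchainσ]
    exact hS
  · rintro ⟨ρ, hρ⟩
    have hsub : (t : Set (Finset (Fin n))) ⊆ upperSets ρ.1.pt := fun S hS =>
      (Set.Finite.mem_toFinset _).1 (hρ hS)
    refine ⟨fun S hS => (hsub hS).1, (isChain_upperSets _).mono hsub, ?_⟩
    obtain ⟨i, j, hij, heq⟩ := ρ.hyp_mem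
    have hpt := hH.pt_mem_of_isGenericIn (hAH ρ.hyp_mem) ρ.isGenericIn
    rw [heq] at hpt
    have hpt' : ρ.1.pt.1 i = ρ.1.pt.1 j := hpt
    refine ⟨i, j, hij, fun S hS => ⟨fun hi => ?_, fun hj => ?_⟩⟩
    · by_contra hj
      exact ((hsub hS).2 i hi j hj).ne hpt'.symm
    · by_contra hi
      exact ((hsub hS).2 j hj i hi).ne hpt'

end Braid

end HypArr

theorem theorem4p2 :
    (∀ (V : Type*) [NormedAddCommGroup V] [InnerProductSpace ℝ V] [FiniteDimensional ℝ V]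
      (H A : Set (Submodule ℝ V)),
      HypArr.IsSimplicialArrangement H → HypArr.IsEmbedded A H → (∀ a ∈ A, IsCoatom a) →
        HypArr.Shellable (HypArr.linkComplex A H)) ∧
    (∀ (n : ℕ) (G : SimpleGraph (Fin n)),
      HypArr.IsSimplicialArrangement (HypArr.braidArrangement n) ∧
      HypArr.Shellable
        (HypArr.linkComplex (HypArr.graphicalArrangement G) (HypArr.braidArrangement n)) ∧
      HypArr.Shellable (HypArr.coloringComplex G)) :=
  ⟨fun _ _ _ _ _ _ hH hA hco => hH.shellable_linkComplex hA hco, fun n G =>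
    ⟨HypArr.isSimplicialArrangement_braidArrangement n,
      HypArr.shellable_linkComplex_graphicalArrangement G, HypArr.shellable_coloringComplex G⟩⟩
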